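/- Conventions. A graph consists of a set $V$ of vertices, a set $E$ of (directed) edges, source and target maps $s,t\colon E\to V$ and a fixed-point-free involution $e\mapsto\bar e$ of $E$ with $s(\bar e)=t(e)$; maps of graphs send vertices to vertices, edges to edges, and preserve this structure. A map of graphs is locally bijective if for each vertex $v$ it maps the set of edges with source $v$ bijectively onto the set of edges whose source is the image of $v$. A graph is path connected if it is nonempty and any two of its vertices are joined by an edge path. A compatible cofinite entourage $R$ of a compact Hausdorff topological graph $\Gamma$ (vertex and edge sets closed, structure maps continuous) is an open equivalence relation with finitely many classes that never relates a vertex to an edge or an edge $e$ to $\bar e$, and is compatible with $s$, $t$ and $e\mapsto\bar e$, so that $\Gamma/R$ is a finite graph. A profinite graph is a compact Hausdorff topological graph in which every neighbourhood of the diagonal contains a compatible cofinite entourage; it is connected if every $\Gamma/R$ is path connected. A covering of profinite graphs is an inverse limit, over a nonempty directed set, of locally bijective maps of finite discrete graphs. The profinite fundamental group is $\hat\pi_1(\Gamma,v)=\varprojlim_R\hat\pi_1(\Gamma/R,R[v])$, where $R$ runs over the compatible cofinite entourages of $\Gamma$ and $\hat\pi_1$ of a finite graph is the profinite completion of its ordinary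 fundamental group. A covering $p\colon\tilde\Delta\to\Delta$ of connected profinite graphs is the universal covering of $\Delta$ if for every covering $f\colon\Gamma\to\Delta$ with $\Gamma$ a connected profinite graph and all vertices $c$ of $\tilde\Delta$ and $a$ of $\Gamma$ with $p(c)=f(a)$ there is a continuous map of graphs $h\colon\tilde\Delta\to\Gamma$ with $f\circ h=p$ and $h(c)=a$. Theorem. Let $\Delta$ and $\tilde\Delta$ be connected profinite graphs and let $p\colon\tilde\Delta\to\Delta$ be a covering. Then $p$ is the universal covering of $\Delta$ if and only if $\hat\pi_1(\tilde\Delta,v)=1$ for every vertex $v$ of $\tilde\Delta$. Moreover, for each single vertex $v$ of $\tilde\Delta$, $p$ is the universal covering of $\Delta$ if and only if $\hat\pi_1(\tilde\Delta,v)=1$; and for any two vertices $v,w$ of $\tilde\Delta$, $\hat\pi_1(\tilde\Delta,v)=1$ if and only if $\hat\pi_1(\tilde\Delta,w)=1$. -/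

import Mathlib

universe u

/-- A graph (in the sense of Serre): vertices, directed edges, source and target maps, and a
fixed-point-free involution reversing the edges. -/
structure SerreGraph where
  V : Type u
  E : Type u
  src : E → V
  tgt : E → V
  rev : E → E
  rev_ne : ∀ e, rev e ≠ e
  rev_rev : ∀ e, rev (rev e) = e
  src_rev : ∀ e, src (rev e) = tgt e

namespace SerreGraph

theorem tgt_rev (Γ : SerreGraph.{u}) (e : Γ.E) : Γ.tgt (Γ.rev e) = Γ.src e := by
  rw [← Γ.src_rev, Γ.rev_rev]

/-- A map of graphs: vertices go to vertices, edges to edges, and the structure is preserved. -/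
@[ext]
structure Hom (Γ Δ : SerreGraph.{u}) where
  onV : Γ.V → Δ.V
  onE : Γ.E → Δ.E
  src_onE : ∀ e, Δ.src (onE e) = onV (Γ.src e)
  tgt_onE : ∀ e, Δ.tgt (onE e) = onV (Γ.tgt e)
  rev_onE : ∀ e, Δ.rev (onE e) = onE (Γ.rev e)

/-- The identity map of a graph. -/
def Hom.id (Γ : SerreGraph.{u}) : Hom Γ Γ where
  onV := fun v => v
  onE := fun e => e
  src_onE _ := rfl
  tgt_onE _ := rfl
  rev_onE _ := rfl

/-- The composite `g ∘ f` of two maps of graphs. -/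
def Hom.comp {Γ Δ Λ : SerreGraph.{u}} (g : Hom Δ Λ) (f : Hom Γ Δ) : Hom Γ Λ where
  onV := fun v => g.onV (f.onV v)
  onE := fun e => g.onE (f.onE e)
  src_onE e := by rw [g.src_onE, f.src_onE]
  tgt_onE e := by rw [g.tgt_onE, f.tgt_onE]
  rev_onE e := by rw [g.rev_onE, f.rev_onE]

/-- A map of graphs is locally bijective if, for every vertex `v`, it maps the set of edges
starting at `v` bijectively onto the set of edges starting at the image of `v`. -/
def Hom.LocallyBijective {Γ Δ : SerreGraph.{u}} (f : Hom Γ Δ) : Prop :=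
  ∀ v : Γ.V, Set.BijOn f.onE {e | Γ.src e = v} {e | Δ.src e = f.onV v}

/-! ### Edge paths and the fundamental group -/

/-- `Γ.IsPath u l w`: the list of edges `l` is an edge path from `u` to `w`. -/
def IsPath (Γ : SerreGraph.{u}) : Γ.V → List Γ.E → Γ.V → Prop
  | u, [], w => u = w
  | u, e :: l, w => Γ.src e = u ∧ IsPath Γ (Γ.tgt e) l w

/-- A graph is path connected if it is nonempty and any two vertices are joined by a path. -/
def PathConnected (Γ : SerreGraph.{u}) : Prop :=
  Nonempty Γ.V ∧ ∀ u w : Γ.V, ∃ l : List Γ.E, Γ.IsPath u l w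

theorem IsPath.append {Γ : SerreGraph.{u}} {l₁ l₂ : List Γ.E} {u v w : Γ.V}
    (h₁ : Γ.IsPath u l₁ v) (h₂ : Γ.IsPath v l₂ w) : Γ.IsPath u (l₁ ++ l₂) w := by
  induction l₁ generalizing u with
  | nil => cases h₁; exact h₂
  | cons e l ih => exact ⟨h₁.1, ih h₁.2⟩

theorem IsPath.reverse {Γ : SerreGraph.{u}} {l : List Γ.E} {u w : Γ.V}
    (h : Γ.IsPath u l w) : Γ.IsPath w (l.map Γ.rev).reverse u := by
  induction l generalizing u with
  | nil => exact Eq.symm h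
  | cons e l ih =>
    rw [List.map_cons, List.reverse_cons]
    exact (ih h.2).append ⟨Γ.src_rev e, (Γ.tgt_rev e).trans h.1⟩

theorem IsPath.map {Γ Δ : SerreGraph.{u}} (f : Hom Γ Δ) {l : List Γ.E} {u w : Γ.V}
    (h : Γ.IsPath u l w) : Δ.IsPath (f.onV u) (l.map f.onE) (f.onV w) := by
  induction l generalizing u with
  | nil => exact congrArg f.onV h
  | cons e l ih =>
    refine ⟨(f.src_onE e).trans (congrArg f.onV h.1), ?_⟩
    rw [f.tgt_onE]
    exact ih h.2

/-- The closed edge paths based at `b`. -/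
def Loop (Γ : SerreGraph.{u}) (b : Γ.V) : Type u := {l : List Γ.E // Γ.IsPath b l b}

/-- Elementary reduction: deleting two consecutive mutually inverse edges. -/
inductive Step (Γ : SerreGraph.{u}) : List Γ.E → List Γ.E → Prop
  | cancel (l₁ : List Γ.E) (e : Γ.E) (l₂ : List Γ.E) :
      Step Γ (l₁ ++ e :: Γ.rev e :: l₂) (l₁ ++ l₂)

/-- Homotopy of closed paths: the equivalence relation generated by elementary reductions. -/
def homotopy (Γ : SerreGraph.{u}) (b : Γ.V) : Setoid (Γ.Loop b) :=
  Relation.EqvGen.setoid (fun p q => Γ.Step p.1 q.1)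

/-- The ordinary fundamental group `π₁(Γ, b)`: homotopy classes of closed paths at `b`. -/
def Pi1 (Γ : SerreGraph.{u}) (b : Γ.V) : Type u := Quotient (Γ.homotopy b)

section Pi1

variable {Γ Δ : SerreGraph.{u}} {b : Γ.V}

/-- Concatenation of closed paths. -/
def Loop.mul (p q : Γ.Loop b) : Γ.Loop b := ⟨p.1 ++ q.1, p.2.append q.2⟩

/-- The reversed closed path. -/
def Loop.inv (p : Γ.Loop b) : Γ.Loop b := ⟨(p.1.map Γ.rev).reverse, p.2.reverse⟩

/-- The constant closed path. -/
def Loop.one (Γ : SerreGraph.{u}) (b : Γ.V) : Γ.Loop b := ⟨[], rfl⟩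

/-- The image of a closed path under a map of graphs. -/
def Loop.map (f : Hom Γ Δ) (p : Γ.Loop b) : Δ.Loop (f.onV b) := ⟨p.1.map f.onE, p.2.map f⟩

theorem Step.append_left {l l' : List Γ.E} (h : Γ.Step l l') (m : List Γ.E) :
    Γ.Step (m ++ l) (m ++ l') := by
  cases h with
  | cancel l₁ e l₂ => simpa using Step.cancel (m ++ l₁) e l₂

theorem Step.append_right {l l' : List Γ.E} (h : Γ.Step l l') (m : List Γ.E) :
    Γ.Step (l ++ m) (l' ++ m) := by
  cases h with
  | cancel l₁ e l₂ => simpa using Step.cancel l₁ e (l₂ ++ m)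

theorem Step.reverse {l l' : List Γ.E} (h : Γ.Step l l') :
    Γ.Step (l.map Γ.rev).reverse (l'.map Γ.rev).reverse := by
  cases h with
  | cancel l₁ e l₂ =>
    have h := Step.cancel (l₂.map Γ.rev).reverse (Γ.rev (Γ.rev e)) (l₁.map Γ.rev).reverse
    rw [Γ.rev_rev (Γ.rev e)] at h
    simpa using h

theorem Step.map (f : Hom Γ Δ) {l l' : List Γ.E} (h : Γ.Step l l') :
    Δ.Step (l.map f.onE) (l'.map f.onE) := by
  cases h with
  | cancel l₁ e l₂ =>
    have h := Step.cancel (Γ := Δ) (l₁.map f.onE) (f.onE e) (l₂.map f.onE)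
    rw [f.rev_onE] at h
    simpa using h

theorem homotopy_of_step {c : Δ.V} (F : Γ.Loop b → Δ.Loop c)
    (hF : ∀ p q : Γ.Loop b, Γ.Step p.1 q.1 → Δ.Step (F p).1 (F q).1)
    {p q : Γ.Loop b} (h : Γ.homotopy b p q) : Δ.homotopy c (F p) (F q) := by
  induction h with
  | rel p q h => exact Relation.EqvGen.rel _ _ (hF p q h)
  | refl p => exact Relation.EqvGen.refl _
  | symm p q _ ih => exact Relation.EqvGen.symm _ _ ih
  | trans p q r _ _ ih₁ ih₂ => exact Relation.EqvGen.trans _ _ _ ih₁ ih₂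

theorem Loop.inv_mul_homotopy (p : Γ.Loop b) :
    Γ.homotopy b (p.inv.mul p) (Loop.one Γ b) := by
  suffices H : ∀ (l : List Γ.E) (u : Γ.V) (_ : Γ.IsPath u l b)
      (hl : Γ.IsPath b ((l.map Γ.rev).reverse ++ l) b),
      Γ.homotopy b ⟨(l.map Γ.rev).reverse ++ l, hl⟩ (Loop.one Γ b) from H p.1 b p.2 _
  intro l
  induction l with
  | nil => intro u hu hl; exact Relation.EqvGen.refl _
  | cons e l ih =>
    intro u hu hl
    refine Relation.EqvGen.trans _ _ _ (Relation.EqvGen.rel _ _ ?_)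
      (ih (Γ.tgt e) hu.2 (hu.2.reverse.append hu.2))
    have h := Step.cancel (Γ := Γ) (l.map Γ.rev).reverse (Γ.rev e) l
    rw [Γ.rev_rev] at h
    simpa using h

instance : Group (Γ.Pi1 b) where
  mul := Quotient.map₂ Loop.mul fun p p' hp q q' hq =>
    Setoid.trans' _ (homotopy_of_step (fun r => r.mul q) (fun _ _ h => h.append_right q.1) hp)
      (homotopy_of_step (fun r => p'.mul r) (fun _ _ h => h.append_left p'.1) hq)
  one := Quotient.mk _ (Loop.one Γ b)
  inv := Quotient.map Loop.inv fun _ _ hp => homotopy_of_step Loop.inv (fun _ _ h => h.reverse) hp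
  mul_assoc := by
    rintro ⟨p⟩ ⟨q⟩ ⟨r⟩
    exact congrArg (Quotient.mk _) (Subtype.ext (List.append_assoc p.1 q.1 r.1))
  one_mul := by
    rintro ⟨p⟩
    rfl
  mul_one := by
    rintro ⟨p⟩
    exact congrArg (Quotient.mk _) (Subtype.ext (List.append_nil p.1))
  inv_mul_cancel := by
    rintro ⟨p⟩
    exact Quotient.sound (Loop.inv_mul_homotopy p)

/-- The homomorphism of fundamental groups induced by a map of graphs. -/
def Pi1.map (f : Hom Γ Δ) (b : Γ.V) : Γ.Pi1 b →* Δ.Pi1 (f.onV b) where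
  toFun := Quotient.map (Loop.map f) fun _ _ h => homotopy_of_step (Loop.map f)
    (fun _ _ h => h.map f) h
  map_one' := rfl
  map_mul' := by
    rintro ⟨p⟩ ⟨q⟩
    exact congrArg (Quotient.mk _) (Subtype.ext List.map_append)

end Pi1

end SerreGraph

/-! ### Topological and profinite graphs -/

/-- A topological graph. A space partitioned into a closed set of vertices and a closed set of
edges is the topological sum of the two, so the two spaces are given separately. -/
structure TopGraph extends SerreGraph.{u} where
  [topV : TopologicalSpace V]
  [topE : TopologicalSpace E]
  continuous_src : Continuous src
  continuous_tgt : Continuous tgt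
  continuous_rev : Continuous rev

namespace TopGraph

instance (Γ : TopGraph.{u}) : TopologicalSpace Γ.V := Γ.topV

instance (Γ : TopGraph.{u}) : TopologicalSpace Γ.E := Γ.topE

/-- A compatible cofinite entourage (on a compact Hausdorff graph): an open equivalence relation
with finitely many classes which relates vertices to vertices and edges to edges, is compatible
with source, target and reversal, and never relates an edge to its reverse. -/
@[ext]
structure CofiniteEntourage (Γ : TopGraph.{u}) where
  relV : Setoid Γ.V
  relE : Setoid Γ.E
  src_rel : ∀ {e e' : Γ.E}, relE e e' → relV (Γ.src e) (Γ.src e')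
  tgt_rel : ∀ {e e' : Γ.E}, relE e e' → relV (Γ.tgt e) (Γ.tgt e')
  rev_rel : ∀ {e e' : Γ.E}, relE e e' → relE (Γ.rev e) (Γ.rev e')
  not_rel_rev : ∀ e : Γ.E, ¬ relE (Γ.rev e) e
  finite_V : Finite (Quotient relV)
  finite_E : Finite (Quotient relE)
  isOpen_V : IsOpen {p : Γ.V × Γ.V | relV p.1 p.2}
  isOpen_E : IsOpen {p : Γ.E × Γ.E | relE p.1 p.2}

namespace CofiniteEntourage

variable {Γ : TopGraph.{u}}

/-- Compatible cofinite entourages are ordered by inclusion. -/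
instance : PartialOrder Γ.CofiniteEntourage :=
  PartialOrder.lift (fun R => (R.relV, R.relE)) fun _ _ h =>
    CofiniteEntourage.ext (congrArg Prod.fst h) (congrArg Prod.snd h)

/-- The (finite) quotient graph `Γ/R`. -/
def quot (R : Γ.CofiniteEntourage) : SerreGraph.{u} where
  V := Quotient R.relV
  E := Quotient R.relE
  src := Quotient.map Γ.src fun _ _ h => R.src_rel h
  tgt := Quotient.map Γ.tgt fun _ _ h => R.tgt_rel h
  rev := Quotient.map Γ.rev fun _ _ h => R.rev_rel h
  rev_ne := by
    rintro ⟨e⟩ h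
    exact R.not_rel_rev e (Quotient.exact h)
  rev_rev := by
    rintro ⟨e⟩
    exact congrArg (Quotient.mk _) (Γ.rev_rev e)
  src_rev := by
    rintro ⟨e⟩
    exact congrArg (Quotient.mk _) (Γ.src_rev e)

/-- The class `R[v]` of a vertex `v`, as a vertex of `Γ/R`. -/
def vertex (R : Γ.CofiniteEntourage) (v : Γ.V) : R.quot.V := Quotient.mk R.relV v

/-- The natural map `Γ/R → Γ/S` for `R ⊆ S`. -/
def quotMap {R S : Γ.CofiniteEntourage} (h : R ≤ S) : SerreGraph.Hom R.quot S.quot where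
  onV := Quotient.map (fun v => v) fun _ _ hr => h.1 hr
  onE := Quotient.map (fun e => e) fun _ _ hr => h.2 hr
  src_onE := by rintro ⟨e⟩; rfl
  tgt_onE := by rintro ⟨e⟩; rfl
  rev_onE := by rintro ⟨e⟩; rfl

end CofiniteEntourage

/-- A continuous map of graphs. -/
@[ext]
structure Hom (Γ Δ : TopGraph.{u}) extends SerreGraph.Hom Γ.toSerreGraph Δ.toSerreGraph where
  continuous_onV : Continuous onV
  continuous_onE : Continuous onE

end TopGraph

/-- A profinite graph: a compact Hausdorff topological graph whose compatible cofinite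
entourages form a fundamental system of entourages. (The entourages of a compact Hausdorff space
are the neighbourhoods of the diagonal.) -/
structure ProfiniteGraph extends TopGraph.{u} where
  compact_V : CompactSpace V
  compact_E : CompactSpace E
  t2_V : T2Space V
  t2_E : T2Space E
  fundamental : ∀ (A : Set (V × V)) (B : Set (E × E)), IsOpen A → IsOpen B →
    (∀ v, (v, v) ∈ A) → (∀ e, (e, e) ∈ B) →
    ∃ R : toTopGraph.CofiniteEntourage,
      (∀ v w, R.relV v w → (v, w) ∈ A) ∧ (∀ e e', R.relE e e' → (e, e') ∈ B)

namespace ProfiniteGraph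

/-- A continuous map of profinite graphs. -/
abbrev Hom (Γ Δ : ProfiniteGraph.{u}) := TopGraph.Hom Γ.toTopGraph Δ.toTopGraph

/-- A profinite graph is connected if all its finite quotient graphs `Γ/R` are path connected. -/
def Connected (Γ : ProfiniteGraph.{u}) : Prop :=
  ∀ R : Γ.CofiniteEntourage, R.quot.PathConnected

/-! ### The profinite fundamental group -/

open CategoryTheory in
/-- The inverse system of ordinary fundamental groups `π₁(Γ/R, R[v])`. -/
def pi1Diagram (Γ : ProfiniteGraph.{u}) (v : Γ.V) : Γ.CofiniteEntourage ⥤ GrpCat.{u} where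
  obj R := GrpCat.of (R.quot.Pi1 (R.vertex v))
  map {R _} h := GrpCat.ofHom
    (SerreGraph.Pi1.map (TopGraph.CofiniteEntourage.quotMap h.le) (R.vertex v))
  map_id R := by
    ext ⟨p⟩
    refine congrArg (Quotient.mk _) (Subtype.ext ?_)
    exact (List.map_congr_left (by rintro ⟨e⟩ _; rfl)).trans (List.map_id p.1)
  map_comp {R S T} h k := by
    ext ⟨p⟩
    refine congrArg (Quotient.mk _) (Subtype.ext ?_)
    refine (List.map_congr_left ?_).trans (List.map_map (l := p.1)).symm
    rintro ⟨e⟩ _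
    rfl

open CategoryTheory in
/-- The profinite fundamental group of `Γ` based at `v`: the inverse limit, over all compatible
cofinite entourages `R`, of the profinite completions of the groups `π₁(Γ/R, R[v])`. -/
noncomputable def profinitePi1 (Γ : ProfiniteGraph.{u}) (v : Γ.V) : ProfiniteGrp.{u} :=
  ProfiniteGrp.limit (Γ.pi1Diagram v ⋙ ProfiniteGrp.profiniteCompletion.{u})

/-! ### Coverings -/

/-- An inverse system of finite discrete graphs indexed by `I`. -/
structure FiniteSystem (I : Type u) [Preorder I] where
  obj : I → SerreGraph.{u}
  finite_V : ∀ i, Finite (obj i).V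
  finite_E : ∀ i, Finite (obj i).E
  trans : ∀ {i j : I}, i ≤ j → SerreGraph.Hom (obj j) (obj i)
  trans_refl : ∀ i : I, trans (le_refl i) = SerreGraph.Hom.id (obj i)
  trans_trans : ∀ {i j k : I} (hij : i ≤ j) (hjk : j ≤ k),
    trans (hij.trans hjk) = (trans hij).comp (trans hjk)

/-- The profinite graph `Γ`, with the projections `φ i`, is the inverse limit of the system `S`:
the projections are continuous for the discrete topologies on the finite graphs, they are
compatible, and they identify the vertices (edges) of `Γ` with the compatible families of
vertices (edges). As `Γ` is compact and the limit is Hausdorff, this identification is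
automatically a homeomorphism. -/
structure FiniteSystem.IsLimit {I : Type u} [Preorder I] (S : FiniteSystem I)
    (Γ : ProfiniteGraph.{u}) (φ : ∀ i, SerreGraph.Hom Γ.toSerreGraph (S.obj i)) : Prop where
  continuous_onV : ∀ i, IsLocallyConstant (φ i).onV
  continuous_onE : ∀ i, IsLocallyConstant (φ i).onE
  compatible : ∀ {i j : I} (h : i ≤ j), (S.trans h).comp (φ j) = φ i
  existsUnique_V : ∀ x : ∀ i, (S.obj i).V,
    (∀ {i j : I} (h : i ≤ j), (S.trans h).onV (x j) = x i) → ∃! v : Γ.V, ∀ i, (φ i).onV v = x i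
  existsUnique_E : ∀ x : ∀ i, (S.obj i).E,
    (∀ {i j : I} (h : i ≤ j), (S.trans h).onE (x j) = x i) → ∃! e : Γ.E, ∀ i, (φ i).onE e = x i

/-- A map of profinite graphs is a covering if it is the inverse limit of an inverse system of
locally bijective maps of finite discrete graphs, indexed by a (nonempty) directed set. -/
def IsCovering {Γ Δ : ProfiniteGraph.{u}} (f : Hom Γ Δ) : Prop :=
  ∃ (I : Type u) (_ : Preorder I) (_ : IsDirectedOrder I) (_ : Nonempty I)
    (S T : FiniteSystem I) (g : ∀ i, SerreGraph.Hom (S.obj i) (T.obj i))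
    (φ : ∀ i, SerreGraph.Hom Γ.toSerreGraph (S.obj i))
    (ψ : ∀ i, SerreGraph.Hom Δ.toSerreGraph (T.obj i)),
    (∀ i, (g i).LocallyBijective) ∧
    (∀ (i j : I) (h : i ≤ j), (g i).comp (S.trans h) = (T.trans h).comp (g j)) ∧
    S.IsLimit Γ φ ∧ T.IsLimit Δ ψ ∧
    ∀ i, (g i).comp (φ i) = (ψ i).comp f.toHom

/-- `p : Γ̃ → Δ` is a universal covering of the connected profinite graph `Δ`: it is a covering by
a connected profinite graph, and it admits a homomorphism of coverings, with any prescribed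
admissible value at a vertex, to every connected profinite covering graph of `Δ`. -/
structure IsUniversalCovering {Γ' Δ : ProfiniteGraph.{u}} (p : Hom Γ' Δ) : Prop where
  connected_base : Δ.Connected
  connected : Γ'.Connected
  isCovering : IsCovering p
  exists_hom : ∀ (Γ : ProfiniteGraph.{u}) (f : Hom Γ Δ), Γ.Connected → IsCovering f →
    ∀ (c : Γ'.V) (a : Γ.V), p.onV c = f.onV a →
      ∃ h : Hom Γ' Γ, f.toHom.comp h.toHom = p.toHom ∧ h.onV c = a

end ProfiniteGraph

/-!
The triviality of `π̂₁(Δ', v)` has an elementary meaning, by compactness of profinite groups and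
density of a group in its profinite completion (`ProfiniteGraph.subsingleton_profinitePi1_iff`): for
every entourage `S` and every normal subgroup `N` of finite index in `π₁(Δ'/S, S[v])` there is a
finer entourage `R` such that `π₁(Δ'/R, R[v])` is mapped into `N`.

Suppose this holds, and let `f : Γ → Δ` be the limit of locally bijective maps `g i : S i → T i` of
finite graphs. The composite `Δ' → Δ → T i` factors through a finite quotient of `Δ'`, whose
fundamental group acts by monodromy on a finite fibre of `g i`. The kernel of this action has finite
index, so the monodromy is trivial on some finer quotient `Δ'/R`, and there the map to `T i` lifts
to `S i`, with any prescribed value at a vertex (`ProfiniteGraph.exists_lift_of_subsingleton`).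
Continuous lifts from a connected profinite graph are determined by their value at one vertex
(`ProfiniteGraph.eq_of_comp_eq`), so the lifts for varying `i` are compatible and give `Δ' → Γ`.

Conversely, let `p : Δ' → Δ` be universal, the limit of maps `g i : S i → T i`, and let `S`, `N` be
as above. Choosing paths from `S[v]` to all vertices labels the edges of `Δ'/S` by elements of
`G = π₁(Δ'/S, S[v]) ⧸ N` in such a way that closed paths at `S[v]` with trivial product of labels
represent elements of `N` (`SerreGraph.exists_label`). For `i` large enough the labels are induced
by labels on the image of `Δ'` in `S i`; they are extended trivially to all of `S i` and pulled back
to the later `S k`. The base components of the derived graphs `S k × G` then form a system of finite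
path connected graphs with locally bijective maps to the `T k`. Its limit is a connected covering of
`Δ`, without any need to show that a composite of coverings of profinite graphs is a covering: a
limit of finite path connected graphs is connected even if the transition maps are not surjective
(`ProfiniteGraph.FiniteSystem.IsLimit.connected`). The map from `Δ'` given by universality is, at
the level `i`, a continuous lift of `Δ' → S i` to the derived graph, hence yields a continuous lift
of `Δ' → Δ'/S` to the derived graph of `Δ'/S`
(`ProfiniteGraph.IsUniversalCovering.exists_lift_derived`). The latter factors through some `Δ'/R`,
so all closed paths at `R[v]` have trivial product of labels.

Both directions work with a single base vertex, which gives all the assertions at once.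
-/

/-! ### Edge paths and lifts along locally bijective maps -/

namespace SerreGraph

variable {Y S T : SerreGraph.{u}}

theorem Hom.comp_assoc {X : SerreGraph.{u}} (h : Hom T X) (g : Hom S T) (f : Hom Y S) :
    (h.comp g).comp f = h.comp (g.comp f) := rfl

theorem IsPath.of_append {l₁ l₂ : List Y.E} {u w : Y.V} (h : Y.IsPath u (l₁ ++ l₂) w) :
    ∃ v, Y.IsPath u l₁ v ∧ Y.IsPath v l₂ w := by
  induction l₁ generalizing u with
  | nil => exact ⟨u, rfl, h⟩
  | cons e l ih =>
    obtain ⟨v, h₁, h₂⟩ := ih h.2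
    exact ⟨v, ⟨h.1, h₁⟩, h₂⟩

theorem Hom.LocallyBijective.eq_of_src_eq {g : Hom S T} (hg : g.LocallyBijective) {d d' : S.E}
    (h₁ : S.src d = S.src d') (h₂ : g.onE d = g.onE d') : d = d' :=
  (hg (S.src d')).injOn h₁ rfl h₂

theorem Hom.LocallyBijective.exists_lift {g : Hom S T} (hg : g.LocallyBijective) {s : S.V}
    {e : T.E} (h : T.src e = g.onV s) : ∃ d, S.src d = s ∧ g.onE d = e :=
  (hg s).surjOn h

theorem Hom.LocallyBijective.comp {g : Hom S T} {f : Hom Y S} (hg : g.LocallyBijective)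
    (hf : f.LocallyBijective) : (g.comp f).LocallyBijective :=
  fun v => (hg (f.onV v)).comp (hf v)

/-- Two lifts of a map from a path connected graph along a locally bijective map are equal if they
agree at one vertex. -/
theorem Hom.LocallyBijective.eq_of_comp_eq {g : Hom S T} (hg : g.LocallyBijective)
    (hY : Y.PathConnected) {k k' : Hom Y S} (h : g.comp k = g.comp k') {c : Y.V}
    (hc : k.onV c = k'.onV c) : k = k' := by
  have hE : ∀ e, g.onE (k.onE e) = g.onE (k'.onE e) := fun e => congrFun (congrArg Hom.onE h) e
  have key : ∀ e, k.onV (Y.src e) = k'.onV (Y.src e) → k.onE e = k'.onE e := fun e he =>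
    hg.eq_of_src_eq (by rw [k.src_onE, k'.src_onE, he]) (hE e)
  have hpath : ∀ (l : List Y.E) (u w : Y.V), Y.IsPath u l w → k.onV u = k'.onV u →
      k.onV w = k'.onV w := by
    intro l
    induction l with
    | nil => rintro u w rfl h; exact h
    | cons e l ih =>
      rintro u w ⟨rfl, h⟩ hu
      refine ih _ _ h ?_
      rw [← k.tgt_onE, ← k'.tgt_onE, key e hu]
  have hV : ∀ w, k.onV w = k'.onV w := fun w => by
    obtain ⟨l, hl⟩ := hY.2 c w
    exact hpath l c w hl hc
  exact Hom.ext (funext hV) (funext fun e => key e (hV _))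

/-! ### Transport of vertices along paths -/

open Classical in
/-- The end of the lift of the edge `e` starting at `s`, for a locally bijective map `g`; the
value is `s` if `e` does not start below `s`. -/
noncomputable def Hom.step (g : Hom S T) (s : S.V) (e : T.E) : S.V :=
  if h : ∃ d, S.src d = s ∧ g.onE d = e then S.tgt h.choose else s

/-- The end of the lift, starting at `s`, of the edge path `l`. -/
noncomputable def Hom.transport (g : Hom S T) (s : S.V) (l : List T.E) : S.V :=
  l.foldl g.step s

namespace Hom.LocallyBijective

variable {g : Hom S T} (hg : g.LocallyBijective)

include hg

theorem step_onE (d : S.E) : g.step (S.src d) (g.onE d) = S.tgt d := by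
  have h : ∃ d', S.src d' = S.src d ∧ g.onE d' = g.onE d := ⟨d, rfl, rfl⟩
  rw [step, dif_pos h, hg.eq_of_src_eq h.choose_spec.1 h.choose_spec.2]

theorem onV_step {s : S.V} {e : T.E} (h : T.src e = g.onV s) : g.onV (g.step s e) = T.tgt e := by
  obtain ⟨d, rfl, rfl⟩ := hg.exists_lift h
  rw [hg.step_onE, g.tgt_onE]

theorem step_step_rev {s : S.V} {e : T.E} (h : T.src e = g.onV s) :
    g.step (g.step s e) (T.rev e) = s := by
  obtain ⟨d, rfl, rfl⟩ := hg.exists_lift h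
  rw [hg.step_onE, g.rev_onE, ← S.src_rev, hg.step_onE, S.tgt_rev]

theorem onV_transport {l : List T.E} {s : S.V} {w : T.V} (h : T.IsPath (g.onV s) l w) :
    g.onV (g.transport s l) = w := by
  induction l generalizing s with
  | nil => exact h
  | cons e l ih =>
    refine ih (s := g.step s e) ?_
    rw [hg.onV_step h.1]
    exact h.2

theorem transport_reverse {l : List T.E} {s : S.V} {w : T.V} (h : T.IsPath (g.onV s) l w) :
    g.transport (g.transport s l) (l.map T.rev).reverse = s := by
  induction l generalizing s with
  | nil => rfl
  | cons e l ih =>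
    have h2 : T.IsPath (g.onV (g.step s e)) l w := by rw [hg.onV_step h.1]; exact h.2
    have := ih h2
    simp only [Hom.transport, List.map_cons, List.reverse_cons, List.foldl_append,
      List.foldl_cons, List.foldl_nil] at this ⊢
    rw [this, hg.step_step_rev h.1]

theorem transport_eq_of_step {l l' : List T.E} (hl : T.Step l l') {s : S.V} {w : T.V}
    (h : T.IsPath (g.onV s) l w) : g.transport s l = g.transport s l' := by
  obtain ⟨l₁, e, l₂⟩ := hl
  obtain ⟨v, h₁, h₂⟩ := h.of_append
  have hv := hg.onV_transport h₁
  have := hg.step_step_rev (h₂.1.trans hv.symm)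
  simp only [Hom.transport, List.foldl_append, List.foldl_cons] at this ⊢
  rw [this]

theorem transport_eq_of_homotopy {s : S.V} {b : T.V} (hs : g.onV s = b) {p q : T.Loop b}
    (h : T.homotopy b p q) : g.transport s p.1 = g.transport s q.1 := by
  subst hs
  induction h with
  | rel p q h => exact hg.transport_eq_of_step h p.2
  | refl p => rfl
  | symm p q _ ih => exact ih.symm
  | trans p q r _ _ ih₁ ih₂ => exact ih₁.trans ih₂

/-- The monodromy action of the fundamental group at `b` on the fibre over `b`. Transport along a
concatenation performs the first path first, hence the opposite monoid. -/
noncomputable def monodromy (b : T.V) :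
    T.Pi1 b →* (Function.End {s : S.V // g.onV s = b})ᵐᵒᵖ where
  toFun := Quotient.lift
    (fun p => MulOpposite.op fun s => ⟨g.transport s.1 p.1,
      hg.onV_transport (s.2.symm ▸ p.2 : T.IsPath (g.onV s.1) p.1 b)⟩)
    fun p q h => congrArg MulOpposite.op
      (funext fun s => Subtype.ext (hg.transport_eq_of_homotopy s.2 h))
  map_one' := rfl
  map_mul' := by
    rintro ⟨p⟩ ⟨q⟩
    refine congrArg MulOpposite.op (funext fun s => Subtype.ext ?_)
    exact List.foldl_append

theorem finiteIndex_ker_monodromy [Finite S.V] (b : T.V) : (hg.monodromy b).ker.FiniteIndex := by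
  have : Finite (Function.End {s : S.V // g.onV s = b}) :=
    inferInstanceAs (Finite ({s : S.V // g.onV s = b} → {s : S.V // g.onV s = b}))
  have h : (hg.monodromy b).ker = (hg.monodromy b).toHomUnits.ker := by
    ext x
    rw [MonoidHom.mem_ker, MonoidHom.mem_ker, Units.ext_iff, MonoidHom.coe_toHomUnits,
      Units.val_one]
  have : Finite (Function.End {s : S.V // g.onV s = b})ᵐᵒᵖ :=
    Finite.of_equiv _ MulOpposite.opEquiv
  have : Finite ((Function.End {s : S.V // g.onV s = b})ᵐᵒᵖ)ˣ :=
    Finite.of_injective _ Units.val_injective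
  rw [h]
  exact Subgroup.finiteIndex_ker _

/-- If the closed paths at one vertex `v` have trivial monodromy, so do those at any other vertex
`c` of a path connected graph, and then a lift is defined by transport along arbitrary paths
starting at `c`. -/
theorem exists_lift_of_transport_eq (hY : Y.PathConnected) (q : Hom Y T) {v : Y.V}
    (hv : ∀ l, Y.IsPath v l v → ∀ s, g.onV s = q.onV v → g.transport s (l.map q.onE) = s)
    {c : Y.V} {s₀ : S.V} (hs₀ : g.onV s₀ = q.onV c) :
    ∃ k : Hom Y S, g.comp k = q ∧ k.onV c = s₀ := by
  have tapp : ∀ (s : S.V) (l l' : List Y.E), g.transport s ((l ++ l').map q.onE) =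
      g.transport (g.transport s (l.map q.onE)) (l'.map q.onE) := fun s l l' => by
    rw [List.map_append]; exact List.foldl_append
  have tproj : ∀ {s u w l}, g.onV s = q.onV u → Y.IsPath u l w →
      g.onV (g.transport s (l.map q.onE)) = q.onV w := fun {s u w l} hs h =>
    hg.onV_transport (by rw [hs]; exact h.map q)
  have trev : ∀ {s u w l}, g.onV s = q.onV u → Y.IsPath u l w →
      g.transport (g.transport s (l.map q.onE)) (((l.map Y.rev).reverse).map q.onE) = s := by
    intro s u w l hs h
    have := hg.transport_reverse (l := l.map q.onE) (s := s) (by rw [hs]; exact h.map q)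
    rw [List.map_reverse, List.map_map]
    rw [List.map_map] at this
    convert this using 4
    exact funext fun e => (q.rev_onE e).symm
  have trev' : ∀ {s u w l}, g.onV s = q.onV w → Y.IsPath u l w →
      g.transport (g.transport s (((l.map Y.rev).reverse).map q.onE)) (l.map q.onE) = s := by
    intro s u w l hs h
    have := trev hs h.reverse
    simpa [List.map_reverse, Function.comp_def, Y.rev_rev] using this
  have hc : ∀ l, Y.IsPath c l c → g.transport s₀ (l.map q.onE) = s₀ := by
    intro l hl
    obtain ⟨t, ht⟩ := hY.2 v c
    have h₁ := tproj hs₀ ht.reverse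
    have h₂ := hv _ ((ht.append hl).append ht.reverse) _ h₁
    rw [tapp, tapp, trev' hs₀ ht] at h₂
    rw [← trev' (tproj hs₀ hl) ht, h₂, trev' hs₀ ht]
  choose t ht using hY.2 c
  -- transport from `s₀` depends only on the end of the path
  have wd : ∀ y l, Y.IsPath c l y →
      g.transport s₀ (l.map q.onE) = g.transport s₀ ((t y).map q.onE) := by
    intro y l hl
    have h := hc _ (hl.append (ht y).reverse)
    rw [tapp] at h
    rw [← trev' (tproj hs₀ hl) (ht y), h]
  have hlift : ∀ e : Y.E, ∃ d, S.src d = g.transport s₀ ((t (Y.src e)).map q.onE) ∧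
      g.onE d = q.onE e := fun e =>
    hg.exists_lift ((q.src_onE e).trans (tproj hs₀ (ht _)).symm)
  choose d hd₁ hd₂ using hlift
  have htgt : ∀ e, S.tgt (d e) = g.transport s₀ ((t (Y.tgt e)).map q.onE) := by
    intro e
    rw [← wd _ (t (Y.src e) ++ [e]) ((ht _).append ⟨rfl, rfl⟩), tapp, ← hd₁]
    change _ = g.step _ _
    rw [← hd₂, hg.step_onE]
  refine ⟨⟨fun y => g.transport s₀ ((t y).map q.onE), d, hd₁, htgt, fun e => ?_⟩, ?_, ?_⟩
  · refine hg.eq_of_src_eq ?_ ?_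
    · rw [S.src_rev, htgt, hd₁, Y.src_rev]
    · rw [← g.rev_onE, hd₂, hd₂, q.rev_onE]
  · exact Hom.ext (funext fun y => tproj hs₀ (ht y)) (funext hd₂)
  · exact (wd c [] rfl).symm

end Hom.LocallyBijective

end SerreGraph

/-! ### Derived graphs and components -/

namespace SerreGraph

variable {Y Z : SerreGraph.{u}} {G : Type u} [Group G]

/-- The derived graph (or skew product) of a graph whose edges are labelled by elements of a group
`G`, inverse edges having inverse labels. -/
def derived (Y : SerreGraph.{u}) (lam : Y.E → G) (hlam : ∀ e, lam (Y.rev e) = (lam e)⁻¹) :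
    SerreGraph.{u} where
  V := Y.V × G
  E := Y.E × G
  src e := (Y.src e.1, e.2)
  tgt e := (Y.tgt e.1, e.2 * lam e.1)
  rev e := (Y.rev e.1, e.2 * lam e.1)
  rev_ne e h := Y.rev_ne e.1 (congrArg Prod.fst h)
  rev_rev e := Prod.ext (Y.rev_rev e.1) (by simp [hlam])
  src_rev e := Prod.ext (Y.src_rev e.1) rfl

section derived

variable {lam : Y.E → G} {hlam : ∀ e, lam (Y.rev e) = (lam e)⁻¹}

/-- The projection of a derived graph. -/
def derivedProj (Y : SerreGraph.{u}) (lam : Y.E → G) (hlam : ∀ e, lam (Y.rev e) = (lam e)⁻¹) :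
    Hom (Y.derived lam hlam) Y where
  onV := Prod.fst
  onE := Prod.fst
  src_onE _ := rfl
  tgt_onE _ := rfl
  rev_onE _ := rfl

theorem derivedProj_locallyBijective : (Y.derivedProj lam hlam).LocallyBijective := by
  rintro ⟨v, g⟩
  refine ⟨fun e he => congrArg Prod.fst he, ?_, fun e he => ⟨(e, g), Prod.ext he rfl, rfl⟩⟩
  rintro ⟨e, a⟩ he ⟨e', a'⟩ he' h
  exact Prod.ext h ((congrArg Prod.snd he).trans (congrArg Prod.snd he').symm)

/-- The map of derived graphs induced by a map of graphs which preserves the labels. -/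
def derivedMap (f : Hom Z Y) (mu : Z.E → G) (hmu : ∀ e, mu (Z.rev e) = (mu e)⁻¹)
    (h : ∀ e, lam (f.onE e) = mu e) : Hom (Z.derived mu hmu) (Y.derived lam hlam) where
  onV x := (f.onV x.1, x.2)
  onE x := (f.onE x.1, x.2)
  src_onE e := Prod.ext (f.src_onE e.1) rfl
  tgt_onE e := Prod.ext (f.tgt_onE e.1) (by simp [derived, h])
  rev_onE e := Prod.ext (f.rev_onE e.1) (by simp [derived, h])

theorem IsPath.prod_derived {l : List (Y.E × G)} {x y : Y.V × G}
    (h : (Y.derived lam hlam).IsPath x l y) :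
    y.2 = x.2 * (l.map fun e => lam e.1).prod := by
  induction l generalizing x with
  | nil => cases h; simp
  | cons e l ih =>
    have h₁ : e.2 = x.2 := congrArg Prod.snd h.1
    rw [ih h.2]
    simp [derived, h₁, mul_assoc]

end derived

/-- The path component of the vertex `b`, with all edges starting at its vertices. -/
def component (Y : SerreGraph.{u}) (b : Y.V) : SerreGraph.{u} where
  V := {v : Y.V // ∃ l, Y.IsPath b l v}
  E := {e : Y.E // ∃ l, Y.IsPath b l (Y.src e)}
  src e := ⟨Y.src e.1, e.2⟩
  tgt e := ⟨Y.tgt e.1, e.2.choose ++ [e.1], e.2.choose_spec.append ⟨rfl, rfl⟩⟩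
  rev e := ⟨Y.rev e.1, e.2.choose ++ [e.1], e.2.choose_spec.append ⟨rfl, (Y.src_rev _).symm⟩⟩
  rev_ne e h := Y.rev_ne e.1 (congrArg Subtype.val h)
  rev_rev e := Subtype.ext (Y.rev_rev e.1)
  src_rev e := Subtype.ext (Y.src_rev e.1)

/-- The inclusion of a component. -/
def componentIncl (Y : SerreGraph.{u}) (b : Y.V) : Hom (Y.component b) Y where
  onV := Subtype.val
  onE := Subtype.val
  src_onE _ := rfl
  tgt_onE _ := rfl
  rev_onE _ := rfl

theorem componentIncl_locallyBijective {b : Y.V} : (Y.componentIncl b).LocallyBijective := by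
  intro v
  refine ⟨fun e he => congrArg Subtype.val he, fun e _ e' _ h => Subtype.ext h, fun e he => ?_⟩
  have he' : Y.src e = v.1 := he
  exact ⟨⟨e, he'.symm ▸ v.2⟩, Subtype.ext he', rfl⟩

theorem component_pathConnected (b : Y.V) : (Y.component b).PathConnected := by
  have key : ∀ (l : List Y.E) (u w : (Y.component b).V), Y.IsPath u.1 l w.1 →
      ∃ m, (Y.component b).IsPath u m w := by
    intro l
    induction l with
    | nil => exact fun u w h => ⟨[], Subtype.ext h⟩
    | cons e l ih =>
      intro u w h
      let e' : (Y.component b).E := ⟨e, h.1.symm ▸ u.2⟩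
      obtain ⟨m, hm⟩ := ih ((Y.component b).tgt e') w h.2
      exact ⟨e' :: m, Subtype.ext h.1, hm⟩
  refine ⟨⟨⟨b, [], rfl⟩⟩, fun u w => ?_⟩
  obtain ⟨l, hl⟩ := u.2
  obtain ⟨m, hm⟩ := w.2
  exact key _ u w (hl.reverse.append hm)

/-- The map of components induced by a map of graphs. -/
def componentMap (f : Hom Z Y) {c : Z.V} {b : Y.V} (h : f.onV c = b) :
    Hom (Z.component c) (Y.component b) where
  onV v := ⟨f.onV v.1, v.2.imp' _ fun _ hl => h ▸ hl.map f⟩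
  onE e := ⟨f.onE e.1, e.2.imp' _ fun _ hl => h ▸ f.src_onE e.1 ▸ hl.map f⟩
  src_onE e := Subtype.ext (f.src_onE e.1)
  tgt_onE e := Subtype.ext (f.tgt_onE e.1)
  rev_onE e := Subtype.ext (f.rev_onE e.1)

/-! ### Labelling edges by elements of the fundamental group -/

/-- Inserting `t⁻¹ t` into a closed path, where `t` need not be closed, does not change its
homotopy class. -/
theorem homotopy_insert {b : Y.V} (A B : List Y.E) :
    ∀ (t : List Y.E) {u w : Y.V} (_ : Y.IsPath u t w) (_ : Y.IsPath b A w) (_ : Y.IsPath w B b)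
      (h : Y.IsPath b (A ++ (t.map Y.rev).reverse ++ (t ++ B)) b) (h' : Y.IsPath b (A ++ B) b),
      Y.homotopy b ⟨A ++ (t.map Y.rev).reverse ++ (t ++ B), h⟩ ⟨A ++ B, h'⟩ := by
  intro t
  induction t with
  | nil =>
    intro u w _ _ _ h h'
    have : (⟨A ++ (([] : List Y.E).map Y.rev).reverse ++ ([] ++ B), h⟩ : Y.Loop b) =
        ⟨A ++ B, h'⟩ := Subtype.ext (by simp)
    rw [this]
    exact Relation.EqvGen.refl _
  | cons e t ih =>
    intro u w ht hA hB h h'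
    refine Relation.EqvGen.trans _ _ _ (Relation.EqvGen.rel _ _ ?_)
      (ih ht.2 hA hB ((hA.append ht.2.reverse).append (ht.2.append hB)) h')
    have h := Step.cancel (Γ := Y) (A ++ (t.map Y.rev).reverse) (Y.rev e) (t ++ B)
    rw [Y.rev_rev] at h
    simpa using h

theorem IsPath.single (e : Y.E) : Y.IsPath (Y.src e) [e] (Y.tgt e) := ⟨rfl, rfl⟩

/-- The homotopy class of a closed path. -/
def Loop.toPi1 {b : Y.V} (p : Y.Loop b) : Y.Pi1 b := Quotient.mk _ p

section label

variable {b : Y.V} {t : Y.V → List Y.E} (ht : ∀ y, Y.IsPath b (t y) y)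

/-- Given paths `t y` from `b` to every vertex `y`, the closed path `t x · l · (t y)⁻¹` obtained
from a path `l` from `x` to `y`. -/
def closeUp {x y : Y.V} (l : List Y.E) (hl : Y.IsPath x l y) : Y.Pi1 b :=
  Quotient.mk _ ⟨t x ++ (l ++ ((t y).map Y.rev).reverse),
    (ht x).append (hl.append (ht y).reverse)⟩

theorem closeUp_append {x y z : Y.V} (l m : List Y.E) (hl : Y.IsPath x l y)
    (hm : Y.IsPath y m z) :
    closeUp ht (l ++ m) (hl.append hm) = closeUp ht l hl * closeUp ht m hm := by
  refine Quotient.sound (Setoid.symm' _ ?_)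
  have := homotopy_insert (t x ++ l) (m ++ ((t z).map Y.rev).reverse) (t y) (ht y)
    ((ht x).append hl) (hm.append (ht z).reverse)
    (((((ht x).append hl).append (ht y).reverse)).append
      ((ht y).append (hm.append (ht z).reverse)))
    (((ht x).append hl).append (hm.append (ht z).reverse))
  simpa only [Loop.mul, List.append_assoc] using this

theorem closeUp_nil (x : Y.V) : closeUp ht (x := x) [] rfl = 1 :=
  mul_eq_left.mp (closeUp_append ht (x := x) [] [] rfl rfl).symm

theorem closeUp_edge_rev (e : Y.E) :
    closeUp ht [Y.rev e] (IsPath.single _) =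
      (closeUp ht [e] (IsPath.single e))⁻¹ := by
  refine congrArg (Quotient.mk _) (Subtype.ext ?_)
  simp [Loop.inv, Function.comp_def, Y.rev_rev, Y.src_rev, Y.tgt_rev]

theorem prod_closeUp {H : Type*} [Monoid H] (ρ : Y.Pi1 b →* H) {x y : Y.V} (l : List Y.E)
    (hl : Y.IsPath x l y) :
    (l.map fun e => ρ (closeUp ht [e] (IsPath.single e))).prod =
      ρ (closeUp ht l hl) := by
  induction l generalizing x with
  | nil => cases hl; simp [closeUp_nil]
  | cons e l ih =>
    obtain ⟨rfl, hl⟩ := hl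
    rw [List.map_cons, List.prod_cons, ih hl, ← map_mul]
    exact congrArg ρ (closeUp_append ht [e] l (IsPath.single e) hl).symm

/-- A path connected graph can be labelled by a quotient of its fundamental group in such a way
that a closed path represents an element of the normal subgroup if the product of its labels is
trivial. -/
theorem exists_label (hY : Y.PathConnected) (b : Y.V) (N : Subgroup (Y.Pi1 b)) [N.Normal] :
    ∃ mu : Y.E → Y.Pi1 b ⧸ N, (∀ e, mu (Y.rev e) = (mu e)⁻¹) ∧
      ∀ p : Y.Loop b, (p.1.map mu).prod = 1 → p.toPi1 ∈ N := by
  choose t ht using hY.2 b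
  refine ⟨fun e => QuotientGroup.mk' N (closeUp ht [e] (IsPath.single e)),
    fun e => ?_, fun p hp => ?_⟩
  · rw [← map_inv, ← closeUp_edge_rev]
  · have hcu : closeUp ht p.1 p.2 =
        (Loop.toPi1 ⟨t b, ht b⟩ : Y.Pi1 b) * p.toPi1 * (Loop.toPi1 ⟨t b, ht b⟩)⁻¹ :=
      congrArg (Quotient.mk _) (Subtype.ext (List.append_assoc _ _ _).symm)
    rw [prod_closeUp ht (QuotientGroup.mk' N) p.1 p.2, QuotientGroup.mk'_apply,
      QuotientGroup.eq_one_iff, hcu] at hp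
    simpa [mul_assoc] using Subgroup.Normal.conj_mem ‹N.Normal› _ hp
      (Loop.toPi1 ⟨t b, ht b⟩ : Y.Pi1 b)⁻¹

end label

end SerreGraph

/-! ### Cofinite entourages and maps to finite graphs -/

namespace TopGraph

variable {Γ : TopGraph.{u}} {X : SerreGraph.{u}}

/-- A map from a topological graph to a discrete graph is continuous. -/
def IsLocConst (φ : SerreGraph.Hom Γ.toSerreGraph X) : Prop :=
  IsLocallyConstant φ.onV ∧ IsLocallyConstant φ.onE

theorem IsLocConst.comp {X' : SerreGraph.{u}} {φ : SerreGraph.Hom Γ.toSerreGraph X}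
    (h : IsLocConst φ) (g : SerreGraph.Hom X X') : IsLocConst (g.comp φ) :=
  ⟨IsLocallyConstant.comp h.1 g.onV, IsLocallyConstant.comp h.2 g.onE⟩

theorem IsLocConst.comp_hom {Γ' : TopGraph.{u}} {φ : SerreGraph.Hom Γ.toSerreGraph X}
    (h : IsLocConst φ) (f : Hom Γ' Γ) : IsLocConst (φ.comp f.toHom) :=
  ⟨h.1.comp_continuous f.continuous_onV, h.2.comp_continuous f.continuous_onE⟩

theorem isOpen_eq_of_isLocallyConstant {A B : Type*} [TopologicalSpace A] {f : A → B}
    (hf : IsLocallyConstant f) : IsOpen {p : A × A | f p.1 = f p.2} :=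
  ((hf.comp_continuous continuous_fst).prodMk (hf.comp_continuous continuous_snd))
    {q | q.1 = q.2}

namespace CofiniteEntourage

/-- The kernel of a continuous map to a finite discrete graph. -/
def ker [Finite X.V] [Finite X.E] (φ : SerreGraph.Hom Γ.toSerreGraph X) (hφ : IsLocConst φ) :
    Γ.CofiniteEntourage where
  relV := Setoid.ker φ.onV
  relE := Setoid.ker φ.onE
  src_rel {e e'} h := by
    have h : φ.onE e = φ.onE e' := h
    change φ.onV _ = φ.onV _
    rw [← φ.src_onE, h, φ.src_onE]
  tgt_rel {e e'} h := by
    have h : φ.onE e = φ.onE e' := h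
    change φ.onV _ = φ.onV _
    rw [← φ.tgt_onE, h, φ.tgt_onE]
  rev_rel {e e'} h := by
    have h : φ.onE e = φ.onE e' := h
    change φ.onE _ = φ.onE _
    rw [← φ.rev_onE, h, φ.rev_onE]
  not_rel_rev e h := X.rev_ne (φ.onE e) ((φ.rev_onE e).trans h)
  finite_V := Finite.of_injective _ (Setoid.kerLift_injective φ.onV)
  finite_E := Finite.of_injective _ (Setoid.kerLift_injective φ.onE)
  isOpen_V := isOpen_eq_of_isLocallyConstant hφ.1
  isOpen_E := isOpen_eq_of_isLocallyConstant hφ.2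

/-- The projection `Γ → Γ/R`. -/
def proj (R : Γ.CofiniteEntourage) : SerreGraph.Hom Γ.toSerreGraph R.quot where
  onV := Quotient.mk _
  onE := Quotient.mk _
  src_onE _ := rfl
  tgt_onE _ := rfl
  rev_onE _ := rfl

theorem proj_isLocConst (R : Γ.CofiniteEntourage) : IsLocConst R.proj := by
  refine ⟨(IsLocallyConstant.iff_exists_open _).2 fun v => ⟨{w | R.relV w v}, ?_, R.relV.refl v,
    fun w hw => Quotient.sound hw⟩, (IsLocallyConstant.iff_exists_open _).2 fun v =>
      ⟨{w | R.relE w v}, ?_, R.relE.refl v, fun w hw => Quotient.sound hw⟩⟩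
  · exact R.isOpen_V.preimage (by fun_prop : Continuous fun w => (w, v))
  · exact R.isOpen_E.preimage (by fun_prop : Continuous fun w => (w, v))

theorem finite_quot_V (R : Γ.CofiniteEntourage) : Finite R.quot.V := R.finite_V

theorem finite_quot_E (R : Γ.CofiniteEntourage) : Finite R.quot.E := R.finite_E

/-- The map `Γ/R → X` induced by a map `Γ → X` which is constant on the classes of `R`. -/
def desc (R : Γ.CofiniteEntourage) (φ : SerreGraph.Hom Γ.toSerreGraph X)
    (hV : ∀ v w, R.relV v w → φ.onV v = φ.onV w) (hE : ∀ e e', R.relE e e' → φ.onE e = φ.onE e') :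
    SerreGraph.Hom R.quot X where
  onV := Quotient.lift φ.onV hV
  onE := Quotient.lift φ.onE hE
  src_onE := by rintro ⟨e⟩; exact φ.src_onE e
  tgt_onE := by rintro ⟨e⟩; exact φ.tgt_onE e
  rev_onE := by rintro ⟨e⟩; exact φ.rev_onE e

theorem le_iff {R S : Γ.CofiniteEntourage} :
    R ≤ S ↔ (∀ v w, R.relV v w → S.relV v w) ∧ (∀ e e', R.relE e e' → S.relE e e') :=
  ⟨fun h => ⟨fun _ _ => @h.1 _ _, fun _ _ => @h.2 _ _⟩,
    fun h => ⟨fun _ _ => h.1 _ _, fun _ _ => h.2 _ _⟩⟩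

instance : Min Γ.CofiniteEntourage where
  min R S :=
    { relV := R.relV ⊓ S.relV
      relE := R.relE ⊓ S.relE
      src_rel := fun h => ⟨R.src_rel h.1, S.src_rel h.2⟩
      tgt_rel := fun h => ⟨R.tgt_rel h.1, S.tgt_rel h.2⟩
      rev_rel := fun h => ⟨R.rev_rel h.1, S.rev_rel h.2⟩
      not_rel_rev := fun e h => R.not_rel_rev e h.1
      finite_V := by
        have := R.finite_V
        have := S.finite_V
        refine Finite.of_injective (β := Quotient R.relV × Quotient S.relV)
          (Quotient.lift (fun v => (Quotient.mk _ v, Quotient.mk _ v)) fun v w h =>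
            Prod.ext (Quotient.sound h.1) (Quotient.sound h.2)) ?_
        rintro ⟨v⟩ ⟨w⟩ h
        exact Quotient.sound ⟨Quotient.exact (congrArg Prod.fst h),
          Quotient.exact (congrArg Prod.snd h)⟩
      finite_E := by
        have := R.finite_E
        have := S.finite_E
        refine Finite.of_injective (β := Quotient R.relE × Quotient S.relE)
          (Quotient.lift (fun v => (Quotient.mk _ v, Quotient.mk _ v)) fun v w h =>
            Prod.ext (Quotient.sound h.1) (Quotient.sound h.2)) ?_
        rintro ⟨v⟩ ⟨w⟩ h
        exact Quotient.sound ⟨Quotient.exact (congrArg Prod.fst h),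
          Quotient.exact (congrArg Prod.snd h)⟩
      isOpen_V := R.isOpen_V.inter S.isOpen_V
      isOpen_E := R.isOpen_E.inter S.isOpen_E }

theorem inf_le_left' (R S : Γ.CofiniteEntourage) : min R S ≤ R :=
  le_iff.2 ⟨fun _ _ h => h.1, fun _ _ h => h.1⟩

theorem inf_le_right' (R S : Γ.CofiniteEntourage) : min R S ≤ S :=
  le_iff.2 ⟨fun _ _ h => h.2, fun _ _ h => h.2⟩

end CofiniteEntourage

end TopGraph

namespace ProfiniteGraph

open TopGraph

variable {Γ : ProfiniteGraph.{u}}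

theorem exists_entourage (Γ : ProfiniteGraph.{u}) : Nonempty Γ.CofiniteEntourage :=
  (Γ.fundamental Set.univ Set.univ isOpen_univ isOpen_univ (fun _ => trivial)
    fun _ => trivial).nonempty

theorem Connected.nonempty (h : Γ.Connected) : Nonempty Γ.V := by
  obtain ⟨R⟩ := Γ.exists_entourage
  obtain ⟨⟨v⟩⟩ := (h R).1
  exact ⟨v⟩

/-- Two continuous lifts to a finite graph of the same map agree on a connected profinite graph if
they agree at one vertex: both factor through a finite, path connected quotient. -/
theorem eq_of_comp_eq (hΓ : Γ.Connected) {S T : SerreGraph.{u}} [Finite S.V] [Finite S.E]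
    {g : SerreGraph.Hom S T} (hg : g.LocallyBijective) {k k' : SerreGraph.Hom Γ.toSerreGraph S}
    (hk : IsLocConst k) (hk' : IsLocConst k') (h : g.comp k = g.comp k') {c : Γ.V}
    (hc : k.onV c = k'.onV c) : k = k' := by
  let R := min (CofiniteEntourage.ker k hk) (CofiniteEntourage.ker k' hk')
  let d := R.desc k (fun _ _ h => h.1) (fun _ _ h => h.1)
  let d' := R.desc k' (fun _ _ h => h.2) (fun _ _ h => h.2)
  have hd : d = d' := by
    refine hg.eq_of_comp_eq (hΓ R) (SerreGraph.Hom.ext ?_ ?_) (c := R.vertex c) hc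
    · funext v
      obtain ⟨v⟩ := v
      exact congrFun (congrArg SerreGraph.Hom.onV h) v
    · funext e
      obtain ⟨e⟩ := e
      exact congrFun (congrArg SerreGraph.Hom.onE h) e
  exact congrArg (fun f => f.comp R.proj) hd

end ProfiniteGraph

/-! ### Compactness of inverse limits -/

/-- In a directed inverse system of compact Hausdorff spaces, a closed subset of one of the spaces
which meets the image of every later one contains a component of a compatible family. -/
theorem exists_compatible_family_mem {I : Type*} [Preorder I] [IsDirectedOrder I] {Y : I → Type*}
    [∀ i, TopologicalSpace (Y i)] [∀ i, CompactSpace (Y i)] [∀ i, T2Space (Y i)]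
    (t : ∀ {i j : I}, i ≤ j → Y j → Y i) (ht : ∀ {i j : I} (h : i ≤ j), Continuous (t h))
    (htt : ∀ {i j k : I} (hij : i ≤ j) (hjk : j ≤ k) (y : Y k),
      t hij (t hjk y) = t (hij.trans hjk) y)
    {i : I} {C : Set (Y i)} (hC : IsClosed C) (h : ∀ {j : I} (hij : i ≤ j), ∃ y, t hij y ∈ C) :
    ∃ x : ∀ k, Y k, (∀ {k j : I} (h : k ≤ j), t h (x j) = x k) ∧ x i ∈ C := by
  classical
  have hne : ∀ k, Nonempty (Y k) := fun k => by
    obtain ⟨j, hij, hkj⟩ := exists_ge_ge i k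
    obtain ⟨y, -⟩ := h hij
    exact ⟨t hkj y⟩
  -- the families which are compatible below the index `j`
  let K : Set.Ici i → Set (∀ k, Y k) := fun j =>
    {x | (∀ k (h : k ≤ j.1), t h (x j.1) = x k) ∧ x i ∈ C}
  have hcl : ∀ j, IsClosed (K j) := fun j => by
    refine IsClosed.inter (s₁ := {x : ∀ k, Y k | ∀ k (h : k ≤ j.1), t h (x j.1) = x k}) ?_
      (hC.preimage (continuous_apply i))
    simp only [Set.ofPred_forall]
    exact isClosed_iInter fun k => isClosed_iInter fun hk =>
      isClosed_eq ((ht hk).comp (continuous_apply _)) (continuous_apply _)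
  have hK : (⋂ j, K j).Nonempty := by
    refine @IsCompact.nonempty_iInter_of_directed_nonempty_isCompact_isClosed _ _ _
      ⟨⟨i, le_rfl⟩⟩ K ?_ ?_ (fun j => (hcl j).isCompact) hcl
    · rintro ⟨j₁, h₁⟩ ⟨j₂, h₂⟩
      obtain ⟨j, h₁', h₂'⟩ := exists_ge_ge j₁ j₂
      refine ⟨⟨j, le_trans h₁ h₁'⟩, fun x hx => ⟨fun k hk => ?_, hx.2⟩,
        fun x hx => ⟨fun k hk => ?_, hx.2⟩⟩
      · rw [← hx.1 j₁ h₁', htt, hx.1]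
      · rw [← hx.1 j₂ h₂', htt, hx.1]
    · rintro ⟨j, hj : i ≤ j⟩
      obtain ⟨y, hy⟩ := h hj
      refine ⟨fun k => if hk : k ≤ j then t hk y else (hne k).some, fun k hk => ?_, ?_⟩
      · simp only [hk, le_refl, dif_pos, htt]
      · change dite (i ≤ j) _ _ ∈ C
        rw [dif_pos hj]
        exact hy
  obtain ⟨x, hx⟩ := hK
  rw [Set.mem_iInter] at hx
  refine ⟨x, fun {k j} hkj => ?_, (hx ⟨i, le_rfl⟩).2⟩
  obtain ⟨m, him, hjm⟩ := exists_ge_ge i j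
  rw [← (hx ⟨m, him⟩).1 j hjm, htt, (hx ⟨m, him⟩).1]

namespace ProfiniteGrp

open CategoryTheory ProfiniteCompletion

/-- A closed subset of a group of a codirected system of profinite groups which meets the image of
every earlier group contains a coordinate of an element of the limit. -/
theorem exists_limit_mem {J : Type u} [Preorder J] [IsCodirectedOrder J]
    (F : J ⥤ ProfiniteGrp.{u}) {j : J} {C : Set (F.obj j)} (hC : IsClosed C)
    (h : ∀ {i : J} (f : i ⟶ j), ∃ y, F.map f y ∈ C) : ∃ x : limit F, x.1 j ∈ C := by
  obtain ⟨x, hx, hxC⟩ := exists_compatible_family_mem (I := Jᵒᵈ)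
    (Y := fun i => F.obj (OrderDual.ofDual i))
    (fun {i k} (h : i ≤ k) => F.map (homOfLE (OrderDual.ofDual_le_ofDual.2 h)))
    (fun h => (F.map _).hom.continuous_toFun)
    (fun {i j k} hij hjk y => by
      rw [← ProfiniteGrp.comp_apply, ← F.map_comp]; rfl)
    (i := OrderDual.toDual j) hC (fun {i} hij => h _)
  exact ⟨⟨x, fun i k f => hx (k := OrderDual.toDual k) (j := OrderDual.toDual i) f.le⟩, hxC⟩

theorem profiniteCompletion_map_etaFn {G H : GrpCat.{u}} (f : G ⟶ H) (x : G) :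
    profiniteCompletion.map f (etaFn G x) = etaFn H (f x) :=
  ConcreteCategory.congr_hom (lift_eta (f ≫ eta H)) x

theorem isClopen_coordinate (G : GrpCat.{u}) (N : FiniteIndexNormalSubgroup G) :
    IsClopen {y : completion G | y.1 N = 1} := by
  have : DiscreteTopology ((ProfiniteCompletion.diagram G).obj N) := ⟨rfl⟩
  have hc : Continuous fun y : completion G => y.1 N :=
    (continuous_apply N).comp continuous_subtype_val
  exact (isClopen_discrete {1}).preimage hc

/-- The inverse limit of the profinite completions of a codirected system of groups is trivial if
and only if every finite quotient of a group of the system is killed by some transition map. If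
not, compactness produces a nontrivial compatible family; conversely, the elements of the groups
themselves are dense in the profinite completions. -/
theorem subsingleton_limit_iff {J : Type u} [Preorder J] [IsCodirectedOrder J]
    (K : J ⥤ GrpCat.{u}) : Subsingleton (limit (K ⋙ profiniteCompletion.{u})) ↔
      ∀ (j : J) (N : FiniteIndexNormalSubgroup (K.obj j)), ∃ (i : J) (f : i ⟶ j),
        ∀ x : K.obj i, K.map f x ∈ N.toSubgroup := by
  constructor
  · intro hs j N
    by_contra! hcon
    obtain ⟨x, hx⟩ := exists_limit_mem (K ⋙ profiniteCompletion.{u}) (j := j)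
      (C := {y : completion (K.obj j) | y.1 N = 1}ᶜ)
      (isClopen_coordinate _ N).compl.isClosed (fun {i} f => by
        obtain ⟨x, hx⟩ := hcon i f
        refine ⟨etaFn _ x, fun h => hx ?_⟩
        have h' : (profiniteCompletion.map (K.map f) (etaFn _ x)).1 N = 1 := h
        rw [profiniteCompletion_map_etaFn] at h'
        exact (QuotientGroup.eq_one_iff _).1 h')
    rw [Subsingleton.elim x 1] at hx
    exact hx rfl
  · intro h
    refine subsingleton_of_forall_eq 1 fun x => limit_ext _ _ _ fun j => Subtype.ext ?_
    funext N
    obtain ⟨i, f, hf⟩ := h j N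
    rw [← x.2 f]
    have hcl : IsClosed {y : completion (K.obj i) |
        (profiniteCompletion.map (K.map f) y).1 N = 1} :=
      (isClopen_coordinate _ N).isClosed.preimage
        (profiniteCompletion.map (K.map f)).hom.continuous_toFun
    have : ∀ y : completion (K.obj i), (profiniteCompletion.map (K.map f) y).1 N = 1 := by
      intro y
      refine (denseRange (K.obj i)).induction_on y hcl fun z => ?_
      rw [profiniteCompletion_map_etaFn]
      exact (QuotientGroup.eq_one_iff _).2 (hf z)
    exact this (x.1 i)

end ProfiniteGrp

namespace ProfiniteGraph

open TopGraph

theorem isCodirected (Γ : ProfiniteGraph.{u}) : IsCodirectedOrder Γ.CofiniteEntourage :=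
  ⟨fun R S => ⟨min R S, R.inf_le_left' S, R.inf_le_right' S⟩⟩

/-- The profinite fundamental group is trivial if and only if every finite quotient of a group
`π₁(Γ/S, S[v])` is killed by the map from `π₁(Γ/R, R[v])` for some finer entourage `R`. -/
theorem subsingleton_profinitePi1_iff (Γ : ProfiniteGraph.{u}) (v : Γ.V) :
    Subsingleton (Γ.profinitePi1 v) ↔
      ∀ (S : Γ.CofiniteEntourage) (N : Subgroup (S.quot.Pi1 (S.vertex v))), N.Normal →
        N.FiniteIndex → ∃ (R : Γ.CofiniteEntourage) (h : R ≤ S),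
          ∀ x, SerreGraph.Pi1.map (CofiniteEntourage.quotMap h) (R.vertex v) x ∈ N := by
  have := Γ.isCodirected
  rw [profinitePi1, ProfiniteGrp.subsingleton_limit_iff]
  constructor
  · intro h S N hN hN'
    obtain ⟨R, f, hf⟩ := h S ⟨N, hN, hN'⟩
    exact ⟨R, f.le, hf⟩
  · intro h S N
    obtain ⟨R, hR, hf⟩ := h S N.toSubgroup N.isNormal' N.isFiniteIndex'
    exact ⟨R, CategoryTheory.homOfLE hR, hf⟩

end ProfiniteGraph

/-! ### Inverse limits of finite sets -/

section

variable {I : Type u} [Preorder I]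

/-- If an increasingly fine directed family of locally constant maps on a compact space separates
points, then the fibres of one of them are small with respect to a given neighbourhood of the
diagonal. -/
theorem exists_fibre_subset [IsDirectedOrder I] [Nonempty I] {X : Type*} [TopologicalSpace X]
    [CompactSpace X] {Y : I → Type*} {f : ∀ i, X → Y i} (hf : ∀ i, IsLocallyConstant (f i))
    (hmono : ∀ {i j : I}, i ≤ j → ∀ {x y}, f j x = f j y → f i x = f i y)
    (hsep : ∀ {x y}, (∀ i, f i x = f i y) → x = y) {A : Set (X × X)} (hA : IsOpen A)
    (hdiag : ∀ x, (x, x) ∈ A) : ∃ i, ∀ x y, f i x = f i y → (x, y) ∈ A := by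
  have hcl : ∀ i, IsClosed {p : X × X | f i p.1 = f i p.2} := fun i =>
    ⟨((hf i).comp_continuous continuous_fst).prodMk
      ((hf i).comp_continuous continuous_snd) {q | q.1 = q.2}ᶜ⟩
  obtain ⟨i, hi⟩ := exists_subset_nhds_of_compactSpace
    (V := fun i => {p : X × X | f i p.1 = f i p.2}) (U := A) (fun i j => by
      obtain ⟨k, hik, hjk⟩ := exists_ge_ge i j
      exact ⟨k, fun p hp => hmono hik hp, fun p hp => hmono hjk hp⟩) hcl (by
      rintro ⟨x, y⟩ hxy
      obtain rfl : x = y := hsep (Set.mem_iInter.1 hxy)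
      exact hA.mem_nhds (hdiag x))
  exact ⟨i, fun x y h => hi h⟩

/-- In an inverse system of finite sets, the image of the limit in a set of the system is the
image of a later set of the system. -/
theorem exists_range_subset [IsDirectedOrder I] {Y : I → Type*} [∀ i, Finite (Y i)]
    (t : ∀ {i j : I}, i ≤ j → Y j → Y i)
    (htt : ∀ {i j k : I} (hij : i ≤ j) (hjk : j ≤ k) (y : Y k),
      t hij (t hjk y) = t (hij.trans hjk) y) {X : Type*} {f : ∀ i, X → Y i}
    (hf : ∀ x : ∀ i, Y i, (∀ {i j : I} (h : i ≤ j), t h (x j) = x i) → ∃ v, ∀ i, f i v = x i)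
    (i : I) : ∃ (j : I) (h : i ≤ j), ∀ y, ∃ v, f i v = t h y := by
  let _ : ∀ i, TopologicalSpace (Y i) := fun _ => ⊥
  have : ∀ i, DiscreteTopology (Y i) := fun _ => ⟨rfl⟩
  by_contra! hcon
  obtain ⟨x, hx, hxi⟩ := exists_compatible_family_mem t (fun _ => continuous_of_discreteTopology)
    htt (i := i) (C := (Set.range (f i))ᶜ) (isClosed_discrete _) (fun {j} hij => by
      obtain ⟨y, hy⟩ := hcon j hij
      exact ⟨y, fun ⟨v, hv⟩ => hy v hv⟩)
  obtain ⟨v, hv⟩ := hf x hx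
  exact hxi ⟨v, hv i⟩

/-- The compatible families of an inverse system of sets. -/
def CompatibleFamily (Y : I → Type u) (t : ∀ i j : I, i ≤ j → Y j → Y i) : Type u :=
  {x : ∀ i, Y i // ∀ i j (h : i ≤ j), t i j h (x j) = x i}

namespace CompatibleFamily

variable {Y : I → Type u} {t : ∀ i j : I, i ≤ j → Y j → Y i}

/-- The inverse limit topology, the sets of the system being discrete. -/
instance : TopologicalSpace (CompatibleFamily Y t) :=
  @instTopologicalSpaceSubtype _ _ (@Pi.topologicalSpace _ _ fun _ => ⊥)

theorem isLocallyConstant (i : I) :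
    IsLocallyConstant (fun x : CompatibleFamily Y t => x.1 i) := by
  let _ : ∀ i, TopologicalSpace (Y i) := fun _ => ⊥
  have : ∀ i, DiscreteTopology (Y i) := fun _ => ⟨rfl⟩
  exact (IsLocallyConstant.iff_continuous _).2 ((continuous_apply i).comp continuous_subtype_val)

theorem continuous_of {X : Type*} [TopologicalSpace X] {f : X → CompatibleFamily Y t}
    (hf : ∀ i, IsLocallyConstant (fun x => (f x).1 i)) : Continuous f := by
  let _ : ∀ i, TopologicalSpace (Y i) := fun _ => ⊥
  exact continuous_induced_rng.2 (continuous_pi fun i => (hf i).continuous)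

instance : T2Space (CompatibleFamily Y t) := by
  let _ : ∀ i, TopologicalSpace (Y i) := fun _ => ⊥
  have : ∀ i, DiscreteTopology (Y i) := fun _ => ⟨rfl⟩
  exact inferInstanceAs (T2Space {x : ∀ i, Y i // _})

instance [∀ i, Finite (Y i)] : CompactSpace (CompatibleFamily Y t) := by
  let _ : ∀ i, TopologicalSpace (Y i) := fun _ => ⊥
  have : ∀ i, DiscreteTopology (Y i) := fun _ => ⟨rfl⟩
  have h : IsClosed {x : ∀ i, Y i | ∀ i j (h : i ≤ j), t i j h (x j) = x i} := ?_
  · exact isCompact_iff_compactSpace.1 h.isCompact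
  simp only [Set.ofPred_forall]
  exact isClosed_iInter fun i => isClosed_iInter fun j => isClosed_iInter fun h =>
    isClosed_eq (continuous_of_discreteTopology.comp (continuous_apply _)) (continuous_apply _)

end CompatibleFamily

end

/-! ### Inverse limits of finite graphs -/

namespace ProfiniteGraph

open TopGraph

namespace FiniteSystem

variable {I : Type u} [Preorder I]

theorem trans_trans_onV (S : FiniteSystem I) {i j k : I} (hij : i ≤ j) (hjk : j ≤ k)
    (x : (S.obj k).V) :
    (S.trans hij).onV ((S.trans hjk).onV x) = (S.trans (hij.trans hjk)).onV x := by
  rw [S.trans_trans hij hjk]; rfl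

theorem trans_trans_onE (S : FiniteSystem I) {i j k : I} (hij : i ≤ j) (hjk : j ≤ k)
    (x : (S.obj k).E) :
    (S.trans hij).onE ((S.trans hjk).onE x) = (S.trans (hij.trans hjk)).onE x := by
  rw [S.trans_trans hij hjk]; rfl

/-- The part of an inverse system above the index `i`. -/
def restrict (S : FiniteSystem I) (i : I) : FiniteSystem (Set.Ici i) where
  obj j := S.obj j.1
  finite_V j := S.finite_V j.1
  finite_E j := S.finite_E j.1
  trans {j k} h := S.trans (i := j.1) (j := k.1) h
  trans_refl j := S.trans_refl j.1
  trans_trans {j k l} h h' := S.trans_trans (i := j.1) (j := k.1) (k := l.1) h h'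

namespace IsLimit

variable {S : FiniteSystem I} {Γ : ProfiniteGraph.{u}}
  {φ : ∀ i, SerreGraph.Hom Γ.toSerreGraph (S.obj i)} (hφ : S.IsLimit Γ φ)

include hφ

theorem isLocConst (i : I) : IsLocConst (φ i) := ⟨hφ.continuous_onV i, hφ.continuous_onE i⟩

theorem trans_onV {i j : I} (h : i ≤ j) (v : Γ.V) : (S.trans h).onV ((φ j).onV v) = (φ i).onV v :=
  congrFun (congrArg SerreGraph.Hom.onV (hφ.compatible h)) v

theorem trans_onE {i j : I} (h : i ≤ j) (v : Γ.E) : (S.trans h).onE ((φ j).onE v) = (φ i).onE v :=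
  congrFun (congrArg SerreGraph.Hom.onE (hφ.compatible h)) v

theorem ext_V {v w : Γ.V} (h : ∀ i, (φ i).onV v = (φ i).onV w) : v = w :=
  (hφ.existsUnique_V _ fun h => hφ.trans_onV h w).unique h fun _ => rfl

theorem ext_E {v w : Γ.E} (h : ∀ i, (φ i).onE v = (φ i).onE w) : v = w :=
  (hφ.existsUnique_E _ fun h => hφ.trans_onE h w).unique h fun _ => rfl

theorem hom_ext {X : SerreGraph.{u}} {f f' : SerreGraph.Hom X Γ.toSerreGraph}
    (h : ∀ i, (φ i).comp f = (φ i).comp f') : f = f' :=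
  SerreGraph.Hom.ext
    (funext fun v => hφ.ext_V fun i => congrFun (congrArg SerreGraph.Hom.onV (h i)) v)
    (funext fun v => hφ.ext_E fun i => congrFun (congrArg SerreGraph.Hom.onE (h i)) v)

theorem exists_fibre_subset_V [IsDirectedOrder I] [Nonempty I] {A : Set (Γ.V × Γ.V)}
    (hA : IsOpen A) (hdiag : ∀ v, (v, v) ∈ A) :
    ∃ i, ∀ v w, (φ i).onV v = (φ i).onV w → (v, w) ∈ A := by
  have := Γ.compact_V
  refine exists_fibre_subset hφ.continuous_onV (fun {i j} h {x y} hxy => ?_) hφ.ext_V hA hdiag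
  rw [← hφ.trans_onV h, hxy, hφ.trans_onV]

theorem exists_fibre_subset_E [IsDirectedOrder I] [Nonempty I] {A : Set (Γ.E × Γ.E)}
    (hA : IsOpen A) (hdiag : ∀ v, (v, v) ∈ A) :
    ∃ i, ∀ v w, (φ i).onE v = (φ i).onE w → (v, w) ∈ A := by
  have := Γ.compact_E
  refine exists_fibre_subset hφ.continuous_onE (fun {i j} h {x y} hxy => ?_) hφ.ext_E hA hdiag
  rw [← hφ.trans_onE h, hxy, hφ.trans_onE]

/-- The kernels of the projections of an inverse limit are cofinal among the entourages. -/
theorem exists_ker_le [IsDirectedOrder I] [Nonempty I] (R : Γ.CofiniteEntourage) :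
    ∃ i, (∀ v w, (φ i).onV v = (φ i).onV w → R.relV v w) ∧
      ∀ e e', (φ i).onE e = (φ i).onE e' → R.relE e e' := by
  obtain ⟨i, hi⟩ := hφ.exists_fibre_subset_V R.isOpen_V R.relV.refl
  obtain ⟨j, hj⟩ := hφ.exists_fibre_subset_E R.isOpen_E R.relE.refl
  obtain ⟨k, hik, hjk⟩ := exists_ge_ge i j
  refine ⟨k, fun v w h => hi v w ?_, fun e e' h => hj e e' ?_⟩
  · rw [← hφ.trans_onV hik, h, hφ.trans_onV]
  · rw [← hφ.trans_onE hjk, h, hφ.trans_onE]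

/-- The universal property of an inverse limit, for maps from profinite graphs. -/
theorem exists_lift [IsDirectedOrder I] [Nonempty I] {Γ' : ProfiniteGraph.{u}}
    {χ : ∀ i, SerreGraph.Hom Γ'.toSerreGraph (S.obj i)} (hχ : ∀ i, IsLocConst (χ i))
    (hcomp : ∀ {i j : I} (h : i ≤ j), (S.trans h).comp (χ j) = χ i) :
    ∃ f : Hom Γ' Γ, ∀ i, (φ i).comp f.toHom = χ i := by
  have := Γ.t2_V
  have := Γ.t2_E
  have hV : ∀ v, ∃ w, ∀ i, (φ i).onV w = (χ i).onV v := fun v =>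
    (hφ.existsUnique_V (fun i => (χ i).onV v) fun h =>
      congrFun (congrArg SerreGraph.Hom.onV (hcomp h)) v).exists
  have hE : ∀ v, ∃ w, ∀ i, (φ i).onE w = (χ i).onE v := fun v =>
    (hφ.existsUnique_E (fun i => (χ i).onE v) fun h =>
      congrFun (congrArg SerreGraph.Hom.onE (hcomp h)) v).exists
  choose fV hfV using hV
  choose fE hfE using hE
  refine ⟨⟨⟨fV, fE, fun e => hφ.ext_V fun i => ?_, fun e => hφ.ext_V fun i => ?_,
    fun e => hφ.ext_E fun i => ?_⟩, ?_, ?_⟩, fun i =>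
      SerreGraph.Hom.ext (funext fun v => hfV v i) (funext fun e => hfE e i)⟩
  · rw [← (φ i).src_onE, hfE, hfV, (χ i).src_onE]
  · rw [← (φ i).tgt_onE, hfE, hfV, (χ i).tgt_onE]
  · rw [← (φ i).rev_onE, hfE, hfE, (χ i).rev_onE]
  · refine continuous_def.2 fun U hU => isOpen_iff_mem_nhds.2 fun x hx => ?_
    -- the neighbourhood of the diagonal is chosen to have `U` as its section at the image of `x`
    obtain ⟨i, hi⟩ := hφ.exists_fibre_subset_V (A := {p | p.1 ≠ fV x ∨ p.2 ∈ U})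
      ((isOpen_ne.preimage continuous_fst).union (hU.preimage continuous_snd))
      (fun v => by
        by_cases h : v = fV x
        · exact Or.inr (by rw [h]; exact hx)
        · exact Or.inl h)
    refine Filter.mem_of_superset (((hχ i).1.isOpen_fiber ((χ i).onV x)).mem_nhds rfl)
      fun y hy => ?_
    exact (hi (fV x) (fV y) (by rw [hfV, hfV]; exact hy.symm)).resolve_left fun h => h rfl
  · refine continuous_def.2 fun U hU => isOpen_iff_mem_nhds.2 fun x hx => ?_
    obtain ⟨i, hi⟩ := hφ.exists_fibre_subset_E (A := {p | p.1 ≠ fE x ∨ p.2 ∈ U})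
      ((isOpen_ne.preimage continuous_fst).union (hU.preimage continuous_snd))
      (fun v => by
        by_cases h : v = fE x
        · exact Or.inr (by rw [h]; exact hx)
        · exact Or.inl h)
    refine Filter.mem_of_superset (((hχ i).2.isOpen_fiber ((χ i).onE x)).mem_nhds rfl)
      fun y hy => ?_
    exact (hi (fE x) (fE y) (by rw [hfE, hfE]; exact hy.symm)).resolve_left fun h => h rfl

/-- An inverse limit of finite path connected graphs is connected, even if the transition maps are
not surjective: a finite quotient is covered by the image of some graph of the system. -/
theorem connected [IsDirectedOrder I] [Nonempty I] (hS : ∀ i, (S.obj i).PathConnected) :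
    Γ.Connected := by
  intro R
  have := S.finite_V
  have := S.finite_E
  obtain ⟨i, hiV, hiE⟩ := hφ.exists_ker_le R
  obtain ⟨j, hij, hjV⟩ := exists_range_subset (fun h => (S.trans h).onV) S.trans_trans_onV
    (fun x hx => (hφ.existsUnique_V x hx).exists) i
  obtain ⟨k, hik, hkE⟩ := exists_range_subset (fun h => (S.trans h).onE) S.trans_trans_onE
    (fun x hx => (hφ.existsUnique_E x hx).exists) i
  have key : ∀ (l : List (S.obj k).E) (a b : (S.obj k).V) (u w : Γ.V), (S.obj k).IsPath a l b →
      (φ i).onV u = (S.trans hik).onV a → (φ i).onV w = (S.trans hik).onV b →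
      ∃ m, R.quot.IsPath (R.vertex u) m (R.vertex w) := by
    intro l
    induction l with
    | nil =>
      rintro a b u w rfl hu hw
      exact ⟨[], Quotient.sound (hiV u w (hu.trans hw.symm))⟩
    | cons e l ih =>
      rintro a b u w ⟨rfl, hl⟩ hu hw
      obtain ⟨e', he'⟩ := hkE e
      obtain ⟨m, hm⟩ := ih _ b (Γ.tgt e') w hl
        (by rw [← (φ i).tgt_onE, he', (S.trans hik).tgt_onE]) hw
      refine ⟨R.proj.onE e' :: m, Quotient.sound (hiV _ _ ?_), hm⟩
      rw [← (φ i).src_onE, he', (S.trans hik).src_onE, hu]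
  refine ⟨?_, ?_⟩
  · obtain ⟨y⟩ := (hS j).1
    obtain ⟨v, -⟩ := hjV y
    exact ⟨R.vertex v⟩
  · rintro ⟨u⟩ ⟨w⟩
    obtain ⟨l, hl⟩ := (hS k).2 ((φ k).onV u) ((φ k).onV w)
    exact key l _ _ u w hl (hφ.trans_onV hik u).symm (hφ.trans_onV hik w).symm

/-- Passing to the indices above `i` does not change the inverse limit. -/
theorem restrict [IsDirectedOrder I] (i : I) : (S.restrict i).IsLimit Γ (fun j => φ j.1) := by
  choose k hk hk' using fun j : I => exists_ge_ge i j
  refine ⟨fun j => hφ.continuous_onV j.1, fun j => hφ.continuous_onE j.1,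
    fun {j j'} h => hφ.compatible (i := j.1) (j := j'.1) h, fun x hx => ?_, fun x hx => ?_⟩
  · let y : ∀ j (h : i ≤ j), (S.obj j).V := fun j h => x ⟨j, h⟩
    have hy : ∀ {j j' : I} (hj : i ≤ j) (h : j ≤ j'),
        (S.trans h).onV (y j' (hj.trans h)) = y j hj := fun {j j'} hj h =>
      hx (i := ⟨j, hj⟩) (j := ⟨j', hj.trans h⟩) h
    obtain ⟨v, hv, -⟩ := hφ.existsUnique_V (fun j => (S.trans (hk' j)).onV (y (k j) (hk j))) (by
      intro j j' h
      obtain ⟨m, hm, hm'⟩ := exists_ge_ge (k j) (k j')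
      rw [← hy (hk j) hm, ← hy (hk j') hm']
      simp only [trans_trans_onV])
    have hv' : ∀ j (hj : i ≤ j), (φ j).onV v = y j hj := fun j hj => by
      rw [hv j]
      exact hy hj (hk' j)
    refine ⟨v, fun j => hv' j.1 j.2, fun w hw => hφ.ext_V fun j => ?_⟩
    rw [← hφ.trans_onV (hk' j), ← hφ.trans_onV (hk' j), hv' _ (hk j)]
    exact congrArg _ (hw ⟨k j, hk j⟩)
  · let y : ∀ j (h : i ≤ j), (S.obj j).E := fun j h => x ⟨j, h⟩
    have hy : ∀ {j j' : I} (hj : i ≤ j) (h : j ≤ j'),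
        (S.trans h).onE (y j' (hj.trans h)) = y j hj := fun {j j'} hj h =>
      hx (i := ⟨j, hj⟩) (j := ⟨j', hj.trans h⟩) h
    obtain ⟨v, hv, -⟩ := hφ.existsUnique_E (fun j => (S.trans (hk' j)).onE (y (k j) (hk j))) (by
      intro j j' h
      obtain ⟨m, hm, hm'⟩ := exists_ge_ge (k j) (k j')
      rw [← hy (hk j) hm, ← hy (hk j') hm']
      simp only [trans_trans_onE])
    have hv' : ∀ j (hj : i ≤ j), (φ j).onE v = y j hj := fun j hj => by
      rw [hv j]
      exact hy hj (hk' j)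
    refine ⟨v, fun j => hv' j.1 j.2, fun w hw => hφ.ext_E fun j => ?_⟩
    rw [← hφ.trans_onE (hk' j), ← hφ.trans_onE (hk' j), hv' _ (hk j)]
    exact congrArg _ (hw ⟨k j, hk j⟩)

end IsLimit

end FiniteSystem

end ProfiniteGraph

namespace ProfiniteGraph

open TopGraph

namespace FiniteSystem

variable {I : Type u} [Preorder I]

/-! ### Construction of inverse limits -/

/-- The compatible families of vertices of an inverse system of finite graphs. -/
abbrev FamV (S : FiniteSystem I) : Type u :=
  CompatibleFamily (fun i => (S.obj i).V) fun _ _ h => (S.trans h).onV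

/-- The compatible families of edges of an inverse system of finite graphs. -/
abbrev FamE (S : FiniteSystem I) : Type u :=
  CompatibleFamily (fun i => (S.obj i).E) fun _ _ h => (S.trans h).onE

theorem isLocallyConstant_famV (S : FiniteSystem I) (i : I) :
    IsLocallyConstant (fun x : S.FamV => x.1 i) := CompatibleFamily.isLocallyConstant i

theorem isLocallyConstant_famE (S : FiniteSystem I) (i : I) :
    IsLocallyConstant (fun x : S.FamE => x.1 i) := CompatibleFamily.isLocallyConstant i

section

variable [Nonempty I]

/-- The inverse limit of an inverse system of finite graphs, as a topological graph whose
vertices and edges are the compatible families of vertices and edges. -/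
def limTop (S : FiniteSystem I) : TopGraph.{u} where
  V := S.FamV
  E := S.FamE
  src := fun e : S.FamE => ⟨fun i => (S.obj i).src (e.1 i), fun i j h =>
    ((S.trans h).src_onE (e.1 j)).symm.trans (congrArg _ (e.2 i j h))⟩
  tgt := fun e : S.FamE => ⟨fun i => (S.obj i).tgt (e.1 i), fun i j h =>
    ((S.trans h).tgt_onE (e.1 j)).symm.trans (congrArg _ (e.2 i j h))⟩
  rev := fun e : S.FamE => ⟨fun i => (S.obj i).rev (e.1 i), fun i j h =>
    ((S.trans h).rev_onE (e.1 j)).symm.trans (congrArg _ (e.2 i j h))⟩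
  rev_ne _ h := (S.obj (Classical.arbitrary I)).rev_ne _
    (congrFun (congrArg Subtype.val h) (Classical.arbitrary I))
  rev_rev _ := Subtype.ext (funext fun i => (S.obj i).rev_rev _)
  src_rev _ := Subtype.ext (funext fun i => (S.obj i).src_rev _)
  continuous_src := CompatibleFamily.continuous_of fun i =>
    (S.isLocallyConstant_famE i).comp (S.obj i).src
  continuous_tgt := CompatibleFamily.continuous_of fun i =>
    (S.isLocallyConstant_famE i).comp (S.obj i).tgt
  continuous_rev := CompatibleFamily.continuous_of fun i =>
    (S.isLocallyConstant_famE i).comp (S.obj i).rev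

/-- The projections of the inverse limit. -/
def limProj (S : FiniteSystem I) (i : I) :
    SerreGraph.Hom S.limTop.toSerreGraph (S.obj i) where
  onV := fun x : S.FamV => x.1 i
  onE := fun x : S.FamE => x.1 i
  src_onE _ := rfl
  tgt_onE _ := rfl
  rev_onE _ := rfl

theorem limProj_isLocConst (S : FiniteSystem I) (i : I) :
    IsLocConst (S.limProj i) :=
  ⟨S.isLocallyConstant_famV i, S.isLocallyConstant_famE i⟩

theorem trans_limProj (S : FiniteSystem I) {i j : I} (h : i ≤ j) :
    (S.trans h).comp (S.limProj j) = S.limProj i :=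
  SerreGraph.Hom.ext (funext fun x : S.FamV => x.2 i j h) (funext fun x : S.FamE => x.2 i j h)

theorem compactSpace_limTop_V (S : FiniteSystem I) : CompactSpace S.limTop.V := by
  have := S.finite_V
  exact inferInstanceAs (CompactSpace S.FamV)

theorem compactSpace_limTop_E (S : FiniteSystem I) : CompactSpace S.limTop.E := by
  have := S.finite_E
  exact inferInstanceAs (CompactSpace S.FamE)

variable [IsDirectedOrder I]

/-- The inverse limit of a directed inverse system of finite graphs, as a profinite graph. -/
def lim (S : FiniteSystem I) : ProfiniteGraph.{u} where
  toTopGraph := S.limTop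
  compact_V := S.compactSpace_limTop_V
  compact_E := S.compactSpace_limTop_E
  t2_V := inferInstanceAs (T2Space S.FamV)
  t2_E := inferInstanceAs (T2Space S.FamE)
  fundamental A B hA hB hAd hBd := by
    have := S.finite_V
    have := S.finite_E
    have := S.compactSpace_limTop_V
    have := S.compactSpace_limTop_E
    have monoV : ∀ {i j : I}, i ≤ j → ∀ {x y}, (S.limProj j).onV x = (S.limProj j).onV y →
        (S.limProj i).onV x = (S.limProj i).onV y := fun {i j} h x y hxy => by
      rw [← S.trans_limProj h]
      exact congrArg (S.trans h).onV hxy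
    have monoE : ∀ {i j : I}, i ≤ j → ∀ {x y}, (S.limProj j).onE x = (S.limProj j).onE y →
        (S.limProj i).onE x = (S.limProj i).onE y := fun {i j} h x y hxy => by
      rw [← S.trans_limProj h]
      exact congrArg (S.trans h).onE hxy
    obtain ⟨i, hi⟩ := exists_fibre_subset (fun i => (S.limProj_isLocConst i).1) monoV
      (fun {x y : S.FamV} h => Subtype.ext (funext h)) hA hAd
    obtain ⟨j, hj⟩ := exists_fibre_subset (fun i => (S.limProj_isLocConst i).2) monoE
      (fun {x y : S.FamE} h => Subtype.ext (funext h)) hB hBd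
    obtain ⟨k, hik, hjk⟩ := exists_ge_ge i j
    have := S.finite_V k
    have := S.finite_E k
    exact ⟨CofiniteEntourage.ker _ (S.limProj_isLocConst k),
      fun v w h => hi v w (monoV hik h), fun e e' h => hj e e' (monoE hjk h)⟩

theorem lim_isLimit (S : FiniteSystem I) : S.IsLimit S.lim S.limProj where
  continuous_onV i := (S.limProj_isLocConst i).1
  continuous_onE i := (S.limProj_isLocConst i).2
  compatible h := S.trans_limProj h
  existsUnique_V x hx := ⟨(⟨x, fun _ _ h => hx h⟩ : S.FamV), fun _ => rfl,
    fun (_ : S.FamV) h => Subtype.ext (funext h)⟩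
  existsUnique_E x hx := ⟨(⟨x, fun _ _ h => hx h⟩ : S.FamE), fun _ => rfl,
    fun (_ : S.FamE) h => Subtype.ext (funext h)⟩

end

/-! ### Derived graphs and components of an inverse system -/

/-- The derived graphs of an inverse system of finite graphs with compatible labels. -/
def derived (S : FiniteSystem I) {G : Type u} [Group G] [Finite G] (lam : ∀ i, (S.obj i).E → G)
    (hlam : ∀ i e, lam i ((S.obj i).rev e) = (lam i e)⁻¹)
    (hcomp : ∀ {i j : I} (h : i ≤ j) e, lam i ((S.trans h).onE e) = lam j e) :
    FiniteSystem I where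
  obj i := (S.obj i).derived (lam i) (hlam i)
  finite_V i := by
    have := S.finite_V i
    exact inferInstanceAs (Finite ((S.obj i).V × G))
  finite_E i := by
    have := S.finite_E i
    exact inferInstanceAs (Finite ((S.obj i).E × G))
  trans h := SerreGraph.derivedMap (S.trans h) _ _ (hcomp h)
  trans_refl i := by
    apply SerreGraph.Hom.ext <;> funext x <;>
      simp only [SerreGraph.derivedMap, S.trans_refl, SerreGraph.Hom.id] <;> rfl
  trans_trans hij hjk := by
    apply SerreGraph.Hom.ext <;> funext x <;>
      simp only [SerreGraph.derivedMap, S.trans_trans hij hjk, SerreGraph.Hom.comp] <;> rfl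

/-- The components of a compatible family of vertices of an inverse system. -/
def component (S : FiniteSystem I) (b : ∀ i, (S.obj i).V)
    (hb : ∀ {i j : I} (h : i ≤ j), (S.trans h).onV (b j) = b i) : FiniteSystem I where
  obj i := (S.obj i).component (b i)
  finite_V i := by
    have := S.finite_V i
    exact Finite.of_injective (β := (S.obj i).V) _ Subtype.val_injective
  finite_E i := by
    have := S.finite_E i
    exact Finite.of_injective (β := (S.obj i).E) _ Subtype.val_injective
  trans h := SerreGraph.componentMap (S.trans h) (hb h)
  trans_refl i := by
    apply SerreGraph.Hom.ext <;> funext x <;>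
      simp only [SerreGraph.componentMap, S.trans_refl, SerreGraph.Hom.id] <;> rfl
  trans_trans hij hjk := by
    apply SerreGraph.Hom.ext <;> funext x <;>
      simp only [SerreGraph.componentMap, S.trans_trans hij hjk, SerreGraph.Hom.comp] <;> rfl

end FiniteSystem

end ProfiniteGraph

namespace ProfiniteGraph

open TopGraph SerreGraph

variable {Δ Δ' : ProfiniteGraph.{u}} {p : Hom Δ' Δ}

/-! ### Simply connected coverings are universal -/

/-- Maps from a profinite graph with trivial profinite fundamental group lift along locally
bijective maps of finite graphs: the monodromy becomes trivial on a sufficiently fine quotient. -/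
theorem exists_lift_of_subsingleton (hΔ' : Δ'.Connected) {v : Δ'.V}
    (hv : Subsingleton (Δ'.profinitePi1 v)) {S T : SerreGraph.{u}} [Finite S.V] [Finite T.V]
    [Finite T.E] {g : SerreGraph.Hom S T} (hg : g.LocallyBijective)
    {q : SerreGraph.Hom Δ'.toSerreGraph T} (hq : IsLocConst q) {c : Δ'.V} {s : S.V}
    (hs : g.onV s = q.onV c) :
    ∃ k : SerreGraph.Hom Δ'.toSerreGraph S, IsLocConst k ∧ g.comp k = q ∧ k.onV c = s := by
  let K := CofiniteEntourage.ker q hq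
  let q₀ : SerreGraph.Hom K.quot T := K.desc q (fun _ _ h => h) (fun _ _ h => h)
  have := hg.finiteIndex_ker_monodromy (q₀.onV (K.vertex v))
  let N : FiniteIndexNormalSubgroup (K.quot.Pi1 (K.vertex v)) :=
    FiniteIndexNormalSubgroup.comap (Pi1.map q₀ (K.vertex v))
      { toSubgroup := (hg.monodromy (q₀.onV (K.vertex v))).ker }
  obtain ⟨R, hR, hRN⟩ := (Δ'.subsingleton_profinitePi1_iff v).1 hv K
    N.toSubgroup N.isNormal' N.isFiniteIndex'
  obtain ⟨k, hk, hkc⟩ := hg.exists_lift_of_transport_eq (hΔ' R)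
    (q₀.comp (CofiniteEntourage.quotMap hR)) (v := R.vertex v) (fun l hl s hs => by
      have h := MulOpposite.op_injective (hRN (Loop.toPi1 ⟨l, hl⟩))
      have h' := congrArg Subtype.val (congrFun h ⟨s, hs⟩)
      refine Eq.trans (congrArg (g.transport s) ?_) h'
      exact (List.map_map (l := l) (f := (CofiniteEntourage.quotMap hR).onE)
        (g := q₀.onE)).symm)
    (c := R.vertex c) (s₀ := s) hs
  exact ⟨k.comp R.proj, R.proj_isLocConst.comp k, congrArg (fun f => f.comp R.proj) hk, hkc⟩

/-- The lifts to the finite graphs whose limit is the given covering exist because the profinite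
fundamental group is trivial, and are compatible because lifts from a connected profinite graph are
unique. -/
theorem isUniversalCovering_of_subsingleton (hΔ : Δ.Connected) (hΔ' : Δ'.Connected)
    (hp : IsCovering p) {v : Δ'.V} (hv : Subsingleton (Δ'.profinitePi1 v)) :
    IsUniversalCovering p where
  connected_base := hΔ
  connected := hΔ'
  isCovering := hp
  exists_hom := by
    rintro Γ f - ⟨I, _, _, _, S, T, g, φ, ψ, hg, hgt, hφ, hψ, hgφ⟩ c a hca
    have := S.finite_V
    have := S.finite_E
    have := T.finite_V
    have := T.finite_E
    have hlift : ∀ i, ∃ k : SerreGraph.Hom Δ'.toSerreGraph (S.obj i), IsLocConst k ∧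
        (g i).comp k = (ψ i).comp p.toHom ∧ k.onV c = (φ i).onV a := fun i =>
      exists_lift_of_subsingleton hΔ' hv (hg i) ((hψ.isLocConst i).comp_hom p)
        ((congrFun (congrArg SerreGraph.Hom.onV (hgφ i)) a).trans
          (congrArg (ψ i).onV hca.symm))
    choose k hk hgk hkc using hlift
    obtain ⟨h, hh⟩ := hφ.exists_lift hk fun {i j} hij => by
      refine eq_of_comp_eq hΔ' (hg i) ((hk j).comp _) (hk i) ?_ (c := c) ?_
      · rw [← Hom.comp_assoc, hgt i j hij, Hom.comp_assoc, hgk j, ← Hom.comp_assoc,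
          hψ.compatible, hgk]
      · exact (congrArg (S.trans hij).onV (hkc j)).trans
          ((hφ.trans_onV hij a).trans (hkc i).symm)
    refine ⟨h, hψ.hom_ext fun i => ?_, hφ.ext_V fun i => ?_⟩
    · rw [← Hom.comp_assoc, ← hgφ, Hom.comp_assoc, hh, hgk]
    · exact (congrFun (congrArg SerreGraph.Hom.onV (hh i)) c).trans (hkc i)

/-! ### Universal coverings are simply connected -/

/-- A labelling of the edges of a finite quotient `Γ/R` extends along a map `φ` from `Γ` to a graph
whose kernel is contained in `R`, edges outside the image of `φ` being labelled trivially. -/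
theorem exists_extend_label {Γ : TopGraph.{u}} (R : Γ.CofiniteEntourage) {X : SerreGraph.{u}}
    (φ : SerreGraph.Hom Γ.toSerreGraph X)
    (hφ : ∀ e e', φ.onE e = φ.onE e' → R.relE e e') {G : Type u} [Group G] {mu : R.quot.E → G}
    (hmu : ∀ e, mu (R.quot.rev e) = (mu e)⁻¹) :
    ∃ lam : X.E → G, (∀ e, lam (X.rev e) = (lam e)⁻¹) ∧
      ∀ e, lam (φ.onE e) = mu (R.proj.onE e) := by
  classical
  let lam : X.E → G := fun x => if h : ∃ e, φ.onE e = x then mu (R.proj.onE h.choose) else 1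
  have hlam : ∀ e, lam (φ.onE e) = mu (R.proj.onE e) := fun e => by
    have h : ∃ e', φ.onE e' = φ.onE e := ⟨e, rfl⟩
    simp only [lam, dif_pos h]
    exact congrArg mu (Quotient.sound (hφ _ _ h.choose_spec))
  refine ⟨lam, fun x => ?_, hlam⟩
  by_cases h : ∃ e, φ.onE e = x
  · obtain ⟨e, rfl⟩ := h
    rw [φ.rev_onE, hlam, hlam, ← R.proj.rev_onE, hmu]
  · have h' : ¬ ∃ e, φ.onE e = X.rev x := fun ⟨e, he⟩ =>
      h ⟨Γ.rev e, by rw [← φ.rev_onE, he, X.rev_rev]⟩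
    simp only [lam, dif_neg h, dif_neg h', inv_one]

/-- If `p : Δ' → Δ` is a universal covering, the projection of `Δ'` to a finite quotient lifts to
every derived graph of the quotient. The labels are transferred to a graph `S i` of a system of
coverings `g k : S k → T k` with limit `p` and pulled back to the later `S k`. The limit of the
components of the derived graphs of the `S k` is a connected covering of `Δ`, and the map from `Δ'`
given by universality restricts to the projection at the level `i` by uniqueness of lifts. -/
theorem IsUniversalCovering.exists_lift_derived (hp : IsUniversalCovering p) (v : Δ'.V)
    (R : Δ'.CofiniteEntourage) {G : Type u} [Group G] [Finite G] (mu : R.quot.E → G)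
    (hmu : ∀ e, mu (R.quot.rev e) = (mu e)⁻¹) :
    ∃ k : SerreGraph.Hom Δ'.toSerreGraph (R.quot.derived mu hmu), IsLocConst k ∧
      (R.quot.derivedProj mu hmu).comp k = R.proj ∧ k.onV v = (R.vertex v, 1) := by
  obtain ⟨I, _, _, _, S, T, g, φ, ψ, hg, hgt, hφ, hψ, hgφ⟩ := hp.isCovering
  obtain ⟨i, -, hi⟩ := hφ.exists_ker_le R
  obtain ⟨lam₀, hlam₀, hlam₀mu⟩ := exists_extend_label R (φ i) hi hmu
  have : Nonempty (Set.Ici i) := ⟨⟨i, le_rfl⟩⟩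
  have : IsDirectedOrder (Set.Ici i) := ⟨fun j k => by
    obtain ⟨m, hjm, hkm⟩ := exists_ge_ge j.1 k.1
    exact ⟨⟨m, le_trans j.2 hjm⟩, hjm, hkm⟩⟩
  let S₁ := S.restrict i
  let T₁ := T.restrict i
  have hφ₁ : S₁.IsLimit Δ' fun j => φ j.1 := hφ.restrict i
  have hψ₁ : T₁.IsLimit Δ fun j => ψ j.1 := hψ.restrict i
  let lam : ∀ j : Set.Ici i, (S₁.obj j).E → G := fun j e => lam₀ ((S.trans j.2).onE e)
  have hlam : ∀ j e, lam j ((S₁.obj j).rev e) = (lam j e)⁻¹ := fun j e =>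
    (congrArg lam₀ ((S.trans j.2).rev_onE e).symm).trans (hlam₀ _)
  let D := S₁.derived lam hlam (fun {j k} h e => congrArg lam₀ (S.trans_trans_onE j.2 h e))
  let b : ∀ j, (D.obj j).V := fun j => ((φ j.1).onV v, 1)
  let C := D.component b fun {j k} h => Prod.ext (hφ₁.trans_onV h v) rfl
  -- the composite covering of `T j`: component, then derived graph, then `S j`
  let toS : ∀ j, SerreGraph.Hom (C.obj j) (S₁.obj j) := fun j =>
    ((S₁.obj j).derivedProj (lam j) (hlam j)).comp ((D.obj j).componentIncl (b j))
  let r : ∀ j, SerreGraph.Hom (C.obj j) (T₁.obj j) := fun j => (g j.1).comp (toS j)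
  have hr : ∀ j, (r j).LocallyBijective := fun j =>
    (hg j.1).comp (derivedProj_locallyBijective.comp componentIncl_locallyBijective)
  have hrt : ∀ (j k : Set.Ici i) (h : j ≤ k), (r j).comp (C.trans h) = (T₁.trans h).comp (r k) :=
    fun j k h => congrArg (fun f => f.comp (toS k)) (hgt j.1 k.1 h)
  obtain ⟨f, hf⟩ := hψ₁.exists_lift (Γ' := C.lim)
    (χ := fun j => (r j).comp (C.limProj j)) (fun j => (C.limProj_isLocConst j).comp (r j))
    fun {j k} h => (congrArg (fun f => f.comp (C.limProj k)) (hrt j k h).symm).trans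
      (congrArg (fun f => (r j).comp f) (C.trans_limProj h))
  have hfcov : IsCovering f := ⟨Set.Ici i, inferInstance, inferInstance, inferInstance, C, T₁, r,
    C.limProj, fun j => ψ j.1, hr, hrt, C.lim_isLimit, hψ₁, fun j => (hf j).symm⟩
  have hconn : C.lim.Connected := C.lim_isLimit.connected fun j => component_pathConnected (b j)
  obtain ⟨a, ha, -⟩ := C.lim_isLimit.existsUnique_V (fun j => ⟨b j, [], rfl⟩) fun {j k} h =>
    Subtype.ext (Prod.ext (hφ₁.trans_onV h v) rfl)
  have hpa : p.onV v = f.onV a := hψ₁.ext_V fun j => by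
    have h₁ : (ψ j.1).onV (f.onV a) = (r j).onV ((C.limProj j).onV a) :=
      congrFun (congrArg SerreGraph.Hom.onV (hf j)) a
    rw [h₁, ha j]
    exact (congrFun (congrArg SerreGraph.Hom.onV (hgφ j.1)) v).symm
  obtain ⟨h, hfh, hha⟩ := hp.exists_hom C.lim f hconn hfcov v a hpa
  -- only the component of `h` at the level `i` matters
  let j₀ : Set.Ici i := ⟨i, le_rfl⟩
  let H : SerreGraph.Hom Δ'.toSerreGraph (D.obj j₀) :=
    (componentIncl _ (b j₀)).comp ((C.limProj j₀).comp h.toHom)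
  have hH : IsLocConst H := ((C.limProj_isLocConst j₀).comp_hom h).comp _
  have hHv : H.onV v = ((φ i).onV v, 1) := by
    have : H.onV v = ((C.limProj j₀).onV (h.onV v)).1 := rfl
    rw [this, hha, ha]
    rfl
  have hHφ : ((S₁.obj j₀).derivedProj (lam j₀) (hlam j₀)).comp H = φ i := by
    have := S.finite_V i
    have := S.finite_E i
    refine eq_of_comp_eq hp.connected (hg i) (hH.comp _) (hφ.isLocConst i) ?_ (c := v)
      (congrArg Prod.fst hHv)
    rw [hgφ i, ← hfh]
    exact (congrArg (fun f => f.comp h.toHom) (hf j₀)).symm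
  have hHE : ∀ e, (H.onE e).1 = (φ i).onE e := fun e =>
    congrFun (congrArg SerreGraph.Hom.onE hHφ) e
  have hHv₂ : (H.onV v).2 = 1 := congrArg Prod.snd hHv
  have hlab : ∀ e, lam j₀ (H.onE e).1 = mu (R.proj.onE e) := fun e => by
    rw [hHE]
    exact (congrArg lam₀ (hφ.trans_onE (le_refl i) e)).trans (hlam₀mu e)
  have hsrc : ∀ e, (H.onE e).2 = (H.onV (Δ'.src e)).2 := fun e => congrArg Prod.snd (H.src_onE e)
  have htgt : ∀ e, (H.onE e).2 * mu (R.proj.onE e) = (H.onV (Δ'.tgt e)).2 := fun e => by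
    rw [← hlab]
    exact congrArg Prod.snd (H.tgt_onE e)
  have hrev : ∀ e, (H.onE e).2 * mu (R.proj.onE e) = (H.onE (Δ'.rev e)).2 := fun e => by
    rw [← hlab]
    exact congrArg Prod.snd (H.rev_onE e)
  exact ⟨⟨fun x => (R.proj.onV x, (H.onV x).2), fun e => (R.proj.onE e, (H.onE e).2),
    fun e => Prod.ext rfl (hsrc e), fun e => Prod.ext rfl (htgt e), fun e => Prod.ext rfl (hrev e)⟩,
    ⟨R.proj_isLocConst.1.prodMk (hH.1.comp Prod.snd),
      R.proj_isLocConst.2.prodMk (hH.2.comp Prod.snd)⟩, rfl,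
    Prod.ext rfl hHv₂⟩

/-- A lift of `Δ' → Δ'/S` to the derived graph labelled by `π₁(Δ'/S, S[v]) ⧸ N` factors through some
`Δ'/R`, and closed paths in `Δ'/R` have closed image there: their classes lie in `N`. -/
theorem IsUniversalCovering.subsingleton_profinitePi1 (hp : IsUniversalCovering p) (v : Δ'.V) :
    Subsingleton (Δ'.profinitePi1 v) := by
  refine (Δ'.subsingleton_profinitePi1_iff v).2 fun S N hN hNfin => ?_
  obtain ⟨mu, hmu, hmuN⟩ := exists_label (hp.connected S) (S.vertex v) N
  obtain ⟨k, hk, hkS, hkv⟩ := hp.exists_lift_derived v S mu hmu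
  have := S.finite_quot_V
  have := S.finite_quot_E
  have : Finite (S.quot.derived mu hmu).V := inferInstanceAs (Finite (S.quot.V × _))
  have : Finite (S.quot.derived mu hmu).E := inferInstanceAs (Finite (S.quot.E × _))
  let R := CofiniteEntourage.ker k hk
  have hkV : ∀ x, (k.onV x).1 = S.proj.onV x := congrFun (congrArg SerreGraph.Hom.onV hkS)
  have hkE : ∀ x, (k.onE x).1 = S.proj.onE x := congrFun (congrArg SerreGraph.Hom.onE hkS)
  have hRS : R ≤ S := CofiniteEntourage.le_iff.2
    ⟨fun x y h => Quotient.exact ((hkV x).symm.trans ((congrArg Prod.fst h).trans (hkV y))),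
      fun x y h => Quotient.exact ((hkE x).symm.trans ((congrArg Prod.fst h).trans (hkE y)))⟩
  refine ⟨R, hRS, ?_⟩
  rintro ⟨l⟩
  refine hmuN (Loop.map (CofiniteEntourage.quotMap hRS) l) ?_
  let d := R.desc k (fun _ _ h => h) (fun _ _ h => h)
  have hd : ∀ e, (d.onE e).1 = (CofiniteEntourage.quotMap hRS).onE e := by
    rintro ⟨e⟩
    exact hkE e
  have h := (l.2.map d).prod_derived
  have h' := left_eq_mul.1 h
  refine Eq.trans (congrArg List.prod ?_) h'
  refine (List.map_map (l := l.1)).trans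
    ((List.map_congr_left fun e _ => ?_).trans (List.map_map (l := l.1)).symm)
  exact congrArg mu (hd e).symm

theorem isUniversalCovering_iff_subsingleton (hΔ : Δ.Connected) (hΔ' : Δ'.Connected)
    (hp : IsCovering p) (v : Δ'.V) :
    IsUniversalCovering p ↔ Subsingleton (Δ'.profinitePi1 v) :=
  ⟨fun h => h.subsingleton_profinitePi1 v, isUniversalCovering_of_subsingleton hΔ hΔ' hp⟩

end ProfiniteGraph

theorem mainTheorem2 (Δ Δ' : ProfiniteGraph.{u}) (p : ProfiniteGraph.Hom Δ' Δ)
    (hΔ : Δ.Connected) (hΔ' : Δ'.Connected) (hp : ProfiniteGraph.IsCovering p) :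
    (ProfiniteGraph.IsUniversalCovering p ↔ ∀ v : Δ'.V, Subsingleton (Δ'.profinitePi1 v)) ∧
    (∀ v : Δ'.V, ProfiniteGraph.IsUniversalCovering p ↔ Subsingleton (Δ'.profinitePi1 v)) ∧
    (∀ v w : Δ'.V, Subsingleton (Δ'.profinitePi1 v) ↔ Subsingleton (Δ'.profinitePi1 w)) := by
  have key := ProfiniteGraph.isUniversalCovering_iff_subsingleton hΔ hΔ' hp
  obtain ⟨v₀⟩ := hΔ'.nonempty
  exact ⟨⟨fun h v => (key v).1 h, fun h => (key v₀).2 (h v₀)⟩, key,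
    fun v w => (key v).symm.trans (key w)⟩
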